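/- All vector spaces are over $\mathbb{C}$. Let $\mathfrak{g}=\mathfrak{n}_-\oplus\mathfrak{h}\oplus\mathfrak{n}_+$ be a Lie algebra with a triangular decomposition in the sense of Moody and Pianzola: $\mathfrak{n}_\pm$ and $\mathfrak{h}$ are subalgebras, $\mathfrak{h}$ is abelian, $\mathfrak{n}_+$ is the sum of its weight spaces for the adjoint action of $\mathfrak{h}$, with nonzero weights in a free additive monoid $Q_+\subset\mathfrak{h}^*$ having a linearly independent basis, and there is an anti-involution $\sigma$ of $\mathfrak{g}$ with $\sigma|_{\mathfrak{h}}=\mathrm{id}$ and $\sigma(\mathfrak{n}_+)=\mathfrak{n}_-$. Let $\mu\in\mathfrak{h}^*$ and let $\lambda:\mathfrak{n}_+\to\mathbb{C}$ be any Lie algebra homomorphism. Let $M_\lambda=U(\mathfrak{g})\otimes_{U(\mathfrak{n}_+)}\mathbb{C}v_\lambda$ be the standard Whittaker module, where $xv_\lambda=\lambda(x)v_\lambda$ for $x\in\mathfrak{n}_+$. Let $N(-\mu)=U(\mathfrak{g})\otimes_{U(\mathfrak{h}\oplus\mathfrak{n}_-)}\mathbb{C}_{-\mu}$ be the lowest weight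 Verma module with lowest weight $-\mu$ ($\mathfrak{n}_-$ acts on $\mathbb{C}_{-\mu}$ by $0$ and $\mathfrak{h}$ by $-\mu$), and let $N(-\mu)^*$ be its full dual with the action $(xf)(u)=-f(xu)$. For a $\mathfrak{g}$-module $V$ put $W_\lambda(V)=\{w\in V: xw=\lambda(x)w\text{ for all }x\in\mathfrak{n}_+\}$. Then $\dim W_\lambda(N(-\mu)^*)=1$, and for each $w\in W_\lambda(N(-\mu)^*)$ there is a unique $\mathfrak{g}$-homomorphism $M_\lambda\to N(-\mu)^*$ with $v_\lambda\mapsto w$. So there is a nonzero homomorphism $M_\lambda\to N(-\mu)^*$, unique up to a scalar; let $L(\lambda,\mu)$ be its image. The $\mathfrak{g}$-module $L(\lambda,\mu)$ is simple, $\dim W_\lambda(L(\lambda,\mu))=1$, and $W_\lambda(L(\lambda,\mu))$ is the set of all Whittaker vectors of $L(\lambda,\mu)$, that is, of all $w$ for which the line $\langle w\rangle$ is $\mathfrak{n}_+$-stable. In particular, let $\mathfrak{g}$ be the Virasoro algebra, with basis $e_i$ ($i\in\mathbb{Z}$) and $z$, where $z$ is central and $[e_i,e_j]=(j-i)e_{i+j}+\delta_{i+j,0}\frac{j^3-j}{12}z$,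 and with $\mathfrak{n}_\pm=\langle e_{\pm i}: i>0\rangle$ and $\mathfrak{h}=\langle e_0,z\rangle$. Then for all $a,b\in\mathbb{C}$ there is exactly one character $\lambda$ of $\mathfrak{n}_+$ with $\lambda(e_1)=a$ and $\lambda(e_2)=b$; and for every $\mu\in\mathfrak{h}^*$ and every character $\lambda$ of $\mathfrak{n}_+$, with no restriction on $\lambda$, the module $L(\lambda,\mu)$ is a simple Whittaker module (a simple module on which $\mathfrak{n}_+$ acts locally finitely) with $\dim W_\lambda(L(\lambda,\mu))=1$. -/

import Mathlib

noncomputable section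

namespace WhittakerPairs

open LieAlgebra Module

universe u v

attribute [local instance 100] LieRing.ofAssociativeRing

/-! ## Lie algebras with triangular decomposition -/

/-- The space of vectors of weight `α` with respect to the adjoint action of a subalgebra `h`. -/
def adWeightSpace {g : Type u} [LieRing g] [LieAlgebra ℂ g] (h : LieSubalgebra ℂ g)
    (α : Dual ℂ h) : Submodule ℂ g where
  carrier := {x | ∀ t : h, ⁅(t : g), x⁆ = α t • x}
  add_mem' := by
    intro a b ha hb t
    rw [lie_add, ha t, hb t, smul_add]
  zero_mem' := by
    intro t
    simp
  smul_mem' := by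
    intro c x hx t
    rw [lie_smul, hx t, smul_comm]

/-- A triangular decomposition `g = n₋ ⊕ h ⊕ n₊` in the sense of Moody and Pianzola: `h` is an
abelian subalgebra, `n₊` is a sum of weight spaces for `h` with nonzero weights in a free additive
monoid `Q₊` with a linearly independent basis `Π ⊆ h*`, and there is an anti-involution `σ` of `g`
which is the identity on `h` and maps `n₊` onto `n₋`.
There is no condition on the dimensions of the root spaces or on the cardinality of `Π`. -/
structure TriangularDecomposition (g : Type u) [LieRing g] [LieAlgebra ℂ g] where
  /-- the subalgebra `h` -/
  cartan : LieSubalgebra ℂ g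
  /-- the subalgebra `n₊` -/
  nPos : LieSubalgebra ℂ g
  /-- the subalgebra `n₋` -/
  nNeg : LieSubalgebra ℂ g
  /-- the basis `Π` of `Q₊` -/
  simpleRoots : Set (Dual ℂ cartan)
  /-- the anti-involution -/
  sigma : g →ₗ[ℂ] g
  cartan_abelian : ∀ x ∈ cartan, ∀ y ∈ cartan, ⁅x, y⁆ = 0
  linearIndependent : LinearIndepOn ℂ id simpleRoots
  weight_decomposition : nPos.toSubmodule =
    ⨆ α ∈ {α : Dual ℂ cartan | α ∈ AddSubmonoid.closure simpleRoots ∧ α ≠ 0},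
      nPos.toSubmodule ⊓ adWeightSpace cartan α
  sigma_sigma : ∀ x, sigma (sigma x) = x
  sigma_lie : ∀ x y, sigma ⁅x, y⁆ = ⁅sigma y, sigma x⁆
  sigma_cartan : ∀ x ∈ cartan, sigma x = x
  sigma_nPos : nPos.toSubmodule.map sigma = nNeg.toSubmodule
  isInternal : DirectSum.IsInternal
    ![nNeg.toSubmodule, cartan.toSubmodule, nPos.toSubmodule]

namespace TriangularDecomposition

variable {g : Type u} [LieRing g] [LieAlgebra ℂ g] (D : TriangularDecomposition g)

lemma isCompl_cartan :
    IsCompl D.cartan.toSubmodule (D.nNeg.toSubmodule ⊔ D.nPos.toSubmodule) := by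
  obtain ⟨hind, htop⟩ := (DirectSum.isInternal_submodule_iff_iSupIndep_and_iSup_eq_top _).1
    D.isInternal
  have h1 := hind 1
  have e : (⨆ j, ⨆ (_ : j ≠ (1 : Fin 3)),
      ![D.nNeg.toSubmodule, D.cartan.toSubmodule, D.nPos.toSubmodule] j) =
      D.nNeg.toSubmodule ⊔ D.nPos.toSubmodule := by
    apply le_antisymm
    · refine iSup_le fun j => iSup_le fun hj => ?_
      fin_cases j
      · exact le_sup_left
      · exact absurd rfl hj
      · exact le_sup_right
    · refine sup_le ?_ ?_
      · exact le_iSup₂_of_le (0 : Fin 3) (by decide) le_rfl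
      · exact le_iSup₂_of_le (2 : Fin 3) (by decide) le_rfl
  rw [e] at h1
  refine ⟨h1, ?_⟩
  rw [codisjoint_iff, eq_top_iff, ← htop]
  refine iSup_le fun j => ?_
  fin_cases j
  · exact le_sup_of_le_right le_sup_left
  · exact le_sup_left
  · exact le_sup_of_le_right le_sup_right

/-- The linear projection of `g` onto `h` with kernel `n₋ ⊕ n₊`. -/
def projCartan : g →ₗ[ℂ] D.cartan :=
  Submodule.projectionOnto _ _ D.isCompl_cartan

lemma projCartan_cartan (t : D.cartan) : D.projCartan t = t :=
  Submodule.projectionOnto_apply_left D.isCompl_cartan t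

lemma projCartan_nNeg {x : g} (hx : x ∈ D.nNeg) : D.projCartan x = 0 :=
  Submodule.projectionOnto_apply_of_mem_right D.isCompl_cartan
    ((le_sup_left : D.nNeg.toSubmodule ≤ _) hx)

lemma lie_cartan_nPos {t x : g} (ht : t ∈ D.cartan) (hx : x ∈ D.nPos) : ⁅t, x⁆ ∈ D.nPos := by
  have key : D.nPos.toSubmodule ≤
      D.nPos.toSubmodule.comap (LieAlgebra.ad ℂ g t : g →ₗ[ℂ] g) := by
    conv_lhs => rw [D.weight_decomposition]
    refine iSup_le fun α => iSup_le fun _ => ?_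
    rintro y ⟨hy, hyα⟩
    have : ⁅t, y⁆ = α ⟨t, ht⟩ • y := hyα ⟨t, ht⟩
    simp only [Submodule.mem_comap, LieAlgebra.ad_apply, this]
    exact Submodule.smul_mem _ _ hy
  exact key hx

lemma lie_cartan_nNeg {t y : g} (ht : t ∈ D.cartan) (hy : y ∈ D.nNeg) : ⁅t, y⁆ ∈ D.nNeg := by
  have hy' : y ∈ D.nPos.toSubmodule.map D.sigma := by
    rw [D.sigma_nPos]
    exact hy
  obtain ⟨x, hx, rfl⟩ := hy'
  have h1 : ⁅t, D.sigma x⁆ = D.sigma ⁅x, t⁆ := by rw [D.sigma_lie, D.sigma_cartan t ht]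
  have h2 : ⁅x, t⁆ ∈ D.nPos := by
    rw [← lie_skew]
    exact neg_mem (D.lie_cartan_nPos ht hx)
  have h3 : D.sigma ⁅x, t⁆ ∈ D.nPos.toSubmodule.map D.sigma := ⟨_, h2, rfl⟩
  rw [D.sigma_nPos] at h3
  rw [h1]
  exact h3

lemma lie_mem_nNeg {x y : g} (hx : x ∈ D.cartan.toSubmodule ⊔ D.nNeg.toSubmodule)
    (hy : y ∈ D.cartan.toSubmodule ⊔ D.nNeg.toSubmodule) : ⁅x, y⁆ ∈ D.nNeg := by
  obtain ⟨s, hs, a, ha, rfl⟩ := Submodule.mem_sup.1 hx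
  obtain ⟨t, ht, b, hb, rfl⟩ := Submodule.mem_sup.1 hy
  rw [lie_add, add_lie, add_lie, D.cartan_abelian s hs t ht, zero_add]
  refine add_mem ?_ (add_mem (D.lie_cartan_nNeg hs hb) (D.nNeg.lie_mem ha hb))
  rw [← lie_skew]
  exact neg_mem (D.lie_cartan_nNeg ht ha)

/-- The subalgebra `h ⊕ n₋`. -/
def borelNeg : LieSubalgebra ℂ g where
  __ := D.cartan.toSubmodule ⊔ D.nNeg.toSubmodule
  lie_mem' := fun hx hy =>
    (le_sup_right : D.nNeg.toSubmodule ≤ D.cartan.toSubmodule ⊔ _) (D.lie_mem_nNeg hx hy)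

/-- The character `h + n ↦ μ h` of `h ⊕ n₋`. -/
def borelNegCharacter (μ : Dual ℂ D.cartan) : LieCharacter ℂ D.borelNeg where
  toLinearMap := μ ∘ₗ D.projCartan ∘ₗ D.borelNeg.toSubmodule.subtype
  map_lie' := by
    intro x y
    change μ (D.projCartan ⁅(x : g), (y : g)⁆) = μ _ * μ _ - μ _ * μ _
    rw [D.projCartan_nNeg (D.lie_mem_nNeg x.2 y.2), map_zero, mul_comm, sub_self]

end TriangularDecomposition

/-! ## Modules induced from one-dimensional modules -/

section Induced

variable {g : Type u} [LieRing g] [LieAlgebra ℂ g]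

/-- The left ideal `∑ U(g) (x - χ(x))`, `x ∈ p`, of the universal enveloping algebra of `g`. -/
def inducedIdeal (p : LieSubalgebra ℂ g) (χ : LieCharacter ℂ p) :
    Submodule (UniversalEnvelopingAlgebra ℂ g) (UniversalEnvelopingAlgebra ℂ g) :=
  Submodule.span _ (Set.range fun x : p =>
    UniversalEnvelopingAlgebra.ι ℂ (x : g) -
      algebraMap ℂ (UniversalEnvelopingAlgebra ℂ g) (χ x))

/-- The induced module `U(g) ⊗_{U(p)} ℂ_χ`, where `ℂ_χ` is the one-dimensional `p`-module with
character `χ`, as the quotient of `U(g)` by the left ideal generated by all `x - χ(x)`. -/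
def Induced (p : LieSubalgebra ℂ g) (χ : LieCharacter ℂ p) : Type u :=
  UniversalEnvelopingAlgebra ℂ g ⧸ inducedIdeal p χ

variable (p : LieSubalgebra ℂ g) (χ : LieCharacter ℂ p)

instance : AddCommGroup (Induced p χ) :=
  inferInstanceAs (AddCommGroup (UniversalEnvelopingAlgebra ℂ g ⧸ inducedIdeal p χ))

instance : Module (UniversalEnvelopingAlgebra ℂ g) (Induced p χ) :=
  inferInstanceAs (Module (UniversalEnvelopingAlgebra ℂ g)
    (UniversalEnvelopingAlgebra ℂ g ⧸ inducedIdeal p χ))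

instance : Module ℂ (Induced p χ) :=
  inferInstanceAs (Module ℂ (UniversalEnvelopingAlgebra ℂ g ⧸ inducedIdeal p χ))

instance : IsScalarTower ℂ (UniversalEnvelopingAlgebra ℂ g) (Induced p χ) :=
  inferInstanceAs (IsScalarTower ℂ (UniversalEnvelopingAlgebra ℂ g)
    (UniversalEnvelopingAlgebra ℂ g ⧸ inducedIdeal p χ))

/-- The Lie algebra `g` acts on the induced module through `g → U(g)`. -/
instance : LieRingModule g (Induced p χ) where
  bracket x m := UniversalEnvelopingAlgebra.ι ℂ x • m
  add_lie x y m := by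
    rw [map_add, add_smul]
  lie_add x m n := smul_add _ m n
  leibniz_lie x y m := by
    change UniversalEnvelopingAlgebra.ι ℂ x • UniversalEnvelopingAlgebra.ι ℂ y • m =
      UniversalEnvelopingAlgebra.ι ℂ ⁅x, y⁆ • m +
        UniversalEnvelopingAlgebra.ι ℂ y • UniversalEnvelopingAlgebra.ι ℂ x • m
    rw [LieHom.map_lie, LieRing.of_associative_ring_bracket, sub_smul, mul_smul, mul_smul,
      sub_add_cancel]

lemma Induced.lie_def (x : g) (m : Induced p χ) :
    ⁅x, m⁆ = UniversalEnvelopingAlgebra.ι ℂ x • m := rfl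

instance : LieModule ℂ g (Induced p χ) where
  smul_lie c x m := by
    rw [Induced.lie_def, Induced.lie_def, map_smul, smul_assoc]
  lie_smul c x m := by
    rw [Induced.lie_def, Induced.lie_def,
      ← algebraMap_smul (UniversalEnvelopingAlgebra ℂ g) c m,
      ← algebraMap_smul (UniversalEnvelopingAlgebra ℂ g) c
        (UniversalEnvelopingAlgebra.ι ℂ x • m), smul_smul, smul_smul, Algebra.commutes]

/-- The canonical generator `1 ⊗ v_χ` of the induced module. -/
def Induced.generator : Induced p χ :=
  Submodule.mkQ (inducedIdeal p χ) 1

end Induced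

/-! ## Whittaker vectors and Whittaker modules -/

namespace TriangularDecomposition

variable {g : Type u} [LieRing g] [LieAlgebra ℂ g] (D : TriangularDecomposition g)

/-- The standard Whittaker module `M_lam = U(g) ⊗_{U(n₊)} L_lam`. -/
abbrev StandardWhittaker (lam : LieCharacter ℂ D.nPos) : Type u :=
  Induced D.nPos lam

/-- The lowest weight Verma module `N(μ)` with lowest weight `μ`. -/
abbrev LowestVerma (μ : Dual ℂ D.cartan) : Type u :=
  Induced D.borelNeg (D.borelNegCharacter μ)

variable (V : Type v) [AddCommGroup V] [Module ℂ V] [LieRingModule g V] [LieModule ℂ g V]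

/-- The space `W_lam(V)` of vectors on which `n₊` acts through the character `lam`. -/
def whittakerSpace (lam : LieCharacter ℂ D.nPos) : Submodule ℂ V where
  carrier := {w | ∀ x : D.nPos, ⁅(x : g), w⁆ = lam x • w}
  add_mem' := by
    intro a b ha hb x
    rw [lie_add, ha x, hb x, smul_add]
  zero_mem' := by
    intro x
    simp
  smul_mem' := by
    intro c w hw x
    rw [lie_smul, hw x, smul_comm]

/-- The set of all Whittaker vectors: those `w` for which the line `⟨w⟩` is `n₊`-stable. -/
def whittakerVectors : Set V :=
  {w | ∀ x : D.nPos, ⁅(x : g), w⁆ ∈ Submodule.span ℂ {w}}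

/-- `V` is a Whittaker module for `(g, n₊)`: the action of `n₊` is locally finite, that is, the
`n₊`-submodule `U(n₊) w` generated by each vector `w` is finite-dimensional. -/
def IsWhittakerModule : Prop :=
  ∀ w : V, FiniteDimensional ℂ (LieSubmodule.lieSpan ℂ D.nPos ({w} : Set V))

end TriangularDecomposition

/-! ## The Virasoro algebra -/

/-- The Virasoro algebra has the basis `e i`, `i ∈ ℤ`, together with a central element `z`: an
element consists of the finitely many coefficients at the `e i` and the coefficient at `z`. -/
@[ext]
structure Virasoro where
  /-- the coefficients at the `e i` -/
  coeff : ℤ →₀ ℂ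
  /-- the coefficient at `z` -/
  central : ℂ

namespace Virasoro

/-- The bilinear form `β` with `[e i, e j] = (j - i) e (i + j)`, extended bilinearly. -/
def wittBracket : (ℤ →₀ ℂ) →ₗ[ℂ] (ℤ →₀ ℂ) →ₗ[ℂ] (ℤ →₀ ℂ) :=
  Finsupp.lift _ ℂ ℤ fun i => Finsupp.lift _ ℂ ℤ fun j =>
    Finsupp.single (i + j) ((j : ℂ) - i)

/-- The cocycle with `(e i, e j) ↦ δ_{i+j,0} (j³ - j) / 12`, extended bilinearly. -/
def cocycle : (ℤ →₀ ℂ) →ₗ[ℂ] (ℤ →₀ ℂ) →ₗ[ℂ] ℂ :=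
  Finsupp.lift _ ℂ ℤ fun i => Finsupp.lift _ ℂ ℤ fun j =>
    if i + j = 0 then ((j : ℂ) ^ 3 - j) / 12 else 0

lemma wittBracket_single (i j : ℤ) (a b : ℂ) :
    wittBracket (Finsupp.single i a) (Finsupp.single j b) =
      Finsupp.single (i + j) (a * b * ((j : ℂ) - i)) := by
  simp [wittBracket, mul_assoc, -Finsupp.single_sub, -Finsupp.single_mul]

lemma cocycle_single (i j : ℤ) (a b : ℂ) :
    cocycle (Finsupp.single i a) (Finsupp.single j b) =
      if i + j = 0 then a * b * (((j : ℂ) ^ 3 - j) / 12) else 0 := by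
  simp [cocycle, mul_assoc]

/-- As a vector space the Virasoro algebra is `ℂ^{(ℤ)} ⊕ ℂ`. -/
def equivProd : Virasoro ≃ (ℤ →₀ ℂ) × ℂ where
  toFun x := (x.coeff, x.central)
  invFun p := ⟨p.1, p.2⟩

instance : AddCommGroup Virasoro := equivProd.addCommGroup

instance : Module ℂ Virasoro := equivProd.module ℂ

@[simp] lemma coeff_add (x y : Virasoro) : (x + y).coeff = x.coeff + y.coeff := rfl
@[simp] lemma central_add (x y : Virasoro) : (x + y).central = x.central + y.central := rfl
@[simp] lemma coeff_zero : (0 : Virasoro).coeff = 0 := rfl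
@[simp] lemma central_zero : (0 : Virasoro).central = 0 := rfl
@[simp] lemma coeff_smul (c : ℂ) (x : Virasoro) : (c • x).coeff = c • x.coeff := rfl
@[simp] lemma central_smul (c : ℂ) (x : Virasoro) : (c • x).central = c * x.central := rfl

/-- The bracket is `[e i, e j] = (j - i) e (i + j) + δ_{i+j,0} (j³ - j) / 12 z`, and `z` is
central. -/
instance : Bracket Virasoro Virasoro where
  bracket x y := ⟨wittBracket x.coeff y.coeff, cocycle x.coeff y.coeff⟩

@[simp] lemma coeff_lie (x y : Virasoro) : ⁅x, y⁆.coeff = wittBracket x.coeff y.coeff := rfl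
@[simp] lemma central_lie (x y : Virasoro) : ⁅x, y⁆.central = cocycle x.coeff y.coeff := rfl

lemma wittBracket_skew (x y : ℤ →₀ ℂ) : wittBracket x y = -wittBracket y x := by
  induction x using Finsupp.induction_linear with
  | zero => simp
  | add f g hf hg => simp only [map_add, LinearMap.add_apply, hf, hg, neg_add]
  | single i a =>
    induction y using Finsupp.induction_linear with
    | zero => simp
    | add f g hf hg => simp only [map_add, LinearMap.add_apply, hf, hg, neg_add]
    | single j b =>
      rw [wittBracket_single, wittBracket_single, ← Finsupp.single_neg, add_comm j i]
      congr 1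
      ring

lemma cocycle_skew (x y : ℤ →₀ ℂ) : cocycle x y = -cocycle y x := by
  induction x using Finsupp.induction_linear with
  | zero => simp
  | add f g hf hg => simp only [map_add, LinearMap.add_apply, hf, hg, neg_add]
  | single i a =>
    induction y using Finsupp.induction_linear with
    | zero => simp
    | add f g hf hg => simp only [map_add, LinearMap.add_apply, hf, hg, neg_add]
    | single j b =>
      rw [cocycle_single, cocycle_single, add_comm j i]
      split_ifs with h
      · obtain rfl : i = -j := by omega
        push_cast
        ring
      · simp

lemma wittBracket_jacobi (x y z : ℤ →₀ ℂ) :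
    wittBracket x (wittBracket y z) =
      wittBracket (wittBracket x y) z + wittBracket y (wittBracket x z) := by
  induction x using Finsupp.induction_linear with
  | zero => simp
  | add f g hf hg =>
    simp only [map_add, LinearMap.add_apply, hf, hg]
    abel
  | single i a =>
    induction y using Finsupp.induction_linear with
    | zero => simp
    | add f g hf hg =>
      simp only [map_add, LinearMap.add_apply, hf, hg]
      abel
    | single j b =>
      induction z using Finsupp.induction_linear with
      | zero => simp
      | add f g hf hg =>
        simp only [map_add, hf, hg]
        abel
      | single k c =>
        simp only [wittBracket_single]
        rw [add_assoc i j k, add_left_comm j i k, ← Finsupp.single_add]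
        congr 1
        push_cast
        ring

lemma cocycle_jacobi (x y z : ℤ →₀ ℂ) :
    cocycle x (wittBracket y z) = cocycle (wittBracket x y) z + cocycle y (wittBracket x z) := by
  induction x using Finsupp.induction_linear with
  | zero => simp
  | add f g hf hg =>
    simp only [map_add, LinearMap.add_apply, hf, hg]
    abel
  | single i a =>
    induction y using Finsupp.induction_linear with
    | zero => simp
    | add f g hf hg =>
      simp only [map_add, LinearMap.add_apply, hf, hg]
      abel
    | single j b =>
      induction z using Finsupp.induction_linear with
      | zero => simp
      | add f g hf hg =>
        simp only [map_add, hf, hg]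
        abel
      | single k c =>
        simp only [wittBracket_single, cocycle_single]
        rw [add_assoc i j k, add_left_comm j i k]
        split_ifs with h
        · obtain rfl : i = -j - k := by omega
          push_cast
          ring
        · simp

instance : LieRing Virasoro where
  add_lie x y z := by ext1 <;> simp
  lie_add x y z := by ext1 <;> simp
  lie_self x := by
    ext1
    · exact self_eq_neg.1 (wittBracket_skew x.coeff x.coeff)
    · exact self_eq_neg.1 (cocycle_skew x.coeff x.coeff)
  leibniz_lie x y z := by
    ext1
    · exact wittBracket_jacobi _ _ _
    · exact cocycle_jacobi _ _ _

instance : LieAlgebra ℂ Virasoro where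
  lie_smul c x y := by ext1 <;> simp

/-- The basis element `e i`. -/
def e (i : ℤ) : Virasoro := ⟨Finsupp.single i 1, 0⟩

/-- The central basis element. -/
def z : Virasoro := ⟨0, 1⟩

lemma e_lie_e (i j : ℤ) : ⁅e i, e j⁆ =
    ((j : ℂ) - i) • e (i + j) + (if i + j = 0 then ((j : ℂ) ^ 3 - j) / 12 else 0) • z := by
  split_ifs with h <;> ext1 <;> simp [e, z, wittBracket_single, cocycle_single, h]

lemma z_lie (x : Virasoro) : ⁅z, x⁆ = 0 := by
  ext1 <;> simp [z]

lemma wittBracket_mem {s t u : Set ℤ} (h : ∀ i ∈ s, ∀ j ∈ t, i + j ∈ u) {x y : ℤ →₀ ℂ}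
    (hx : x ∈ Finsupp.supported ℂ ℂ s) (hy : y ∈ Finsupp.supported ℂ ℂ t) :
    wittBracket x y ∈ Finsupp.supported ℂ ℂ u := by
  rw [Finsupp.supported_eq_span_single] at hx hy
  induction hx using Submodule.span_induction with
  | zero => simp
  | add a b _ _ ha hb =>
    rw [map_add]
    exact add_mem ha hb
  | smul c a _ ha =>
    rw [map_smul]
    exact Submodule.smul_mem _ c ha
  | mem a ha =>
    obtain ⟨i, hi, rfl⟩ := ha
    induction hy using Submodule.span_induction with
    | zero => simp
    | add a b _ _ ha hb =>
      rw [map_add]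
      exact add_mem ha hb
    | smul c a _ ha =>
      rw [map_smul]
      exact Submodule.smul_mem _ c ha
    | mem b hb =>
      obtain ⟨j, hj, rfl⟩ := hb
      change wittBracket (Finsupp.single i 1) (Finsupp.single j 1) ∈ _
      rw [wittBracket_single]
      exact Finsupp.single_mem_supported ℂ _ (h i hi j hj)

lemma cocycle_eq_zero {s t : Set ℤ} (h : ∀ i ∈ s, ∀ j ∈ t, i + j = 0 → (j : ℂ) ^ 3 - j = 0)
    {x y : ℤ →₀ ℂ}
    (hx : x ∈ Finsupp.supported ℂ ℂ s) (hy : y ∈ Finsupp.supported ℂ ℂ t) :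
    cocycle x y = 0 := by
  rw [Finsupp.supported_eq_span_single] at hx hy
  induction hx using Submodule.span_induction with
  | zero => simp
  | add a b _ _ ha hb => simp [ha, hb]
  | smul c a _ ha => simp [ha]
  | mem a ha =>
    obtain ⟨i, hi, rfl⟩ := ha
    induction hy using Submodule.span_induction with
    | zero => simp
    | add a b _ _ ha hb => simp only [map_add, ha, hb, add_zero]
    | smul c a _ ha => simp only [map_smul, ha, smul_zero]
    | mem b hb =>
      obtain ⟨j, hj, rfl⟩ := hb
      change cocycle (Finsupp.single i 1) (Finsupp.single j 1) = _
      rw [cocycle_single]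
      split_ifs with hij
      · rw [h i hi j hj hij]
        simp
      · rfl

/-- The coefficients at the `e i`, as a linear map. -/
def coeffₗ : Virasoro →ₗ[ℂ] (ℤ →₀ ℂ) where
  toFun := coeff
  map_add' := coeff_add
  map_smul' := coeff_smul

/-- The coefficient at `z`, as a linear map. -/
def centralₗ : Virasoro →ₗ[ℂ] ℂ where
  toFun := central
  map_add' := central_add
  map_smul' := central_smul

/-- The subalgebra `h` spanned by `e 0` and `z`. -/
def cartan : LieSubalgebra ℂ Virasoro where
  __ := (Finsupp.supported ℂ ℂ ({0} : Set ℤ)).comap coeffₗ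
  lie_mem' := fun hx hy =>
    wittBracket_mem (by rintro i rfl j rfl; simp) hx hy

/-- The subalgebra `n₊` spanned by the `e i` with `i > 0`. -/
def nPos : LieSubalgebra ℂ Virasoro where
  __ := (Finsupp.supported ℂ ℂ {i : ℤ | 0 < i}).comap coeffₗ ⊓ LinearMap.ker centralₗ
  lie_mem' := fun hx hy =>
    ⟨wittBracket_mem (fun i hi j hj => by simp only [Set.mem_ofPred_eq] at *; omega) hx.1 hy.1,
      cocycle_eq_zero (fun i hi j hj h => by simp only [Set.mem_ofPred_eq] at *; omega)
        hx.1 hy.1⟩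

/-- The subalgebra `n₋` spanned by the `e i` with `i < 0`. -/
def nNeg : LieSubalgebra ℂ Virasoro where
  __ := (Finsupp.supported ℂ ℂ {i : ℤ | i < 0}).comap coeffₗ ⊓ LinearMap.ker centralₗ
  lie_mem' := fun hx hy =>
    ⟨wittBracket_mem (fun i hi j hj => by simp only [Set.mem_ofPred_eq] at *; omega) hx.1 hy.1,
      cocycle_eq_zero (fun i hi j hj h => by simp only [Set.mem_ofPred_eq] at *; omega)
        hx.1 hy.1⟩

/-- The anti-involution `e i ↦ e (-i)`, `z ↦ z`. -/
def sigma : Virasoro →ₗ[ℂ] Virasoro where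
  toFun x := ⟨Finsupp.lmapDomain ℂ ℂ (fun i : ℤ => -i) x.coeff, x.central⟩
  map_add' x y := by ext1 <;> simp only [coeff_add, central_add, map_add]
  map_smul' c x := by ext1 <;> simp

/-- The linear form on `h` with `e 0 ↦ 1` and `z ↦ 0`. -/
def simpleRoot : Dual ℂ cartan :=
  Finsupp.lapply 0 ∘ₗ coeffₗ ∘ₗ cartan.toSubmodule.subtype

lemma e_zero_mem_cartan : e 0 ∈ cartan :=
  Finsupp.single_mem_supported ℂ _ rfl

lemma simpleRoot_e_zero : simpleRoot ⟨e 0, e_zero_mem_cartan⟩ = 1 :=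
  Finsupp.single_eq_same

lemma e_mem_nPos {i : ℤ} (hi : 0 < i) : e i ∈ nPos :=
  ⟨Finsupp.single_mem_supported ℂ _ hi, rfl⟩

lemma cartan_eq {t : Virasoro} (ht : t ∈ cartan) :
    t.coeff = Finsupp.single 0 (t.coeff 0) := by
  ext i
  by_cases hi : i = 0
  · simp [hi]
  · rw [Finsupp.single_apply, if_neg (Ne.symm hi)]
    exact (Finsupp.mem_supported' ℂ _).1 ht i hi

lemma e_mem_adWeightSpace (n : ℕ) : e n ∈ adWeightSpace cartan (n • simpleRoot) := by
  intro t
  ext1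
  · rw [coeff_lie, cartan_eq t.2]
    have h : (n • simpleRoot) t = n * (t : Virasoro).coeff 0 := by
      rw [LinearMap.smul_apply, nsmul_eq_mul]
      rfl
    rw [h, e, wittBracket_single, coeff_smul, Finsupp.smul_single, zero_add, smul_eq_mul]
    congr 1
    push_cast
    ring
  · rw [central_lie, cartan_eq t.2]
    simp only [e, cocycle_single, zero_add, central_smul, mul_zero]
    split_ifs with h
    · simp [h]
    · rfl

lemma sigma_sigma (x : Virasoro) : sigma (sigma x) = x := by
  ext1
  · change Finsupp.mapDomain _ (Finsupp.mapDomain _ x.coeff) = x.coeff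
    rw [← Finsupp.mapDomain_comp]
    convert Finsupp.mapDomain_id
    simp
  · rfl

lemma mem_nNeg_iff (x : Virasoro) : x ∈ nNeg ↔ (∀ i, 0 ≤ i → x.coeff i = 0) ∧ x.central = 0 := by
  change x.coeff ∈ Finsupp.supported ℂ ℂ {i : ℤ | i < 0} ∧ x.central = 0 ↔ _
  rw [Finsupp.mem_supported']
  simp

lemma mem_nPos_iff (x : Virasoro) : x ∈ nPos ↔ (∀ i, i ≤ 0 → x.coeff i = 0) ∧ x.central = 0 := by
  change x.coeff ∈ Finsupp.supported ℂ ℂ {i : ℤ | 0 < i} ∧ x.central = 0 ↔ _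
  rw [Finsupp.mem_supported']
  simp

lemma mem_cartan_iff (x : Virasoro) : x ∈ cartan ↔ ∀ i, i ≠ 0 → x.coeff i = 0 := by
  change x.coeff ∈ Finsupp.supported ℂ ℂ {0} ↔ _
  rw [Finsupp.mem_supported']
  simp

lemma sigma_coeff (x : Virasoro) (i : ℤ) : (sigma x).coeff i = x.coeff (-i) := by
  change Finsupp.mapDomain (fun i : ℤ => -i) x.coeff i = _
  conv_lhs => rw [← neg_neg i]
  exact Finsupp.mapDomain_apply neg_injective _ _

lemma sigma_lie (x y : Virasoro) : sigma ⁅x, y⁆ = ⁅sigma y, sigma x⁆ := by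
  have h : ∀ x y : ℤ →₀ ℂ, Finsupp.lmapDomain ℂ ℂ (fun i : ℤ => -i) (wittBracket x y) =
      wittBracket (Finsupp.lmapDomain ℂ ℂ (fun i : ℤ => -i) y)
        (Finsupp.lmapDomain ℂ ℂ (fun i : ℤ => -i) x) ∧
      cocycle x y = cocycle (Finsupp.lmapDomain ℂ ℂ (fun i : ℤ => -i) y)
        (Finsupp.lmapDomain ℂ ℂ (fun i : ℤ => -i) x) := by
    intro x y
    induction x using Finsupp.induction_linear with
    | zero => simp
    | add f g hf hg =>
      simp only [map_add, LinearMap.add_apply, hf.1, hg.1, hf.2, hg.2, and_self]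
    | single i a =>
      induction y using Finsupp.induction_linear with
      | zero => simp
      | add f g hf hg =>
        simp only [map_add, LinearMap.add_apply, hf.1, hg.1, hf.2, hg.2, and_self]
      | single j b =>
        simp only [Finsupp.lmapDomain_apply, Finsupp.mapDomain_single, wittBracket_single,
          cocycle_single]
        constructor
        · rw [neg_add, add_comm (-i)]
          congr 1
          push_cast
          ring
        · have e1 : -j + -i = 0 ↔ i + j = 0 := by omega
          simp only [e1]
          split_ifs with hij
          · obtain rfl : i = -j := by omega
            push_cast
            ring
          · rfl
  ext1
  · exact (h _ _).1
  · exact (h _ _).2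

lemma iSupIndep_three {M : Type u} [AddCommGroup M] [Module ℂ M] {a b c : Submodule ℂ M}
    (h0 : Disjoint a (b ⊔ c)) (h1 : Disjoint b (a ⊔ c)) (h2 : Disjoint c (a ⊔ b)) :
    iSupIndep ![a, b, c] := by
  intro k
  have e : (⨆ j, ⨆ (_ : j ≠ k), ![a, b, c] j) ≤ ![b ⊔ c, a ⊔ c, a ⊔ b] k := by
    refine iSup_le fun j => iSup_le fun hj => ?_
    fin_cases k <;> fin_cases j <;> simp at hj ⊢
  refine Disjoint.mono_right e ?_
  fin_cases k
  · exact h0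
  · exact h1
  · exact h2

lemma isInternal : DirectSum.IsInternal
    ![nNeg.toSubmodule, cartan.toSubmodule, nPos.toSubmodule] := by
  apply DirectSum.isInternal_submodule_of_iSupIndep_of_iSup_eq_top
  · refine iSupIndep_three ?_ ?_ ?_
    · refine disjoint_iff_inf_le.2 ?_
      rintro x ⟨hx, hx'⟩
      obtain ⟨s, hs, t, ht, rfl⟩ := Submodule.mem_sup.1 hx'
      replace hx := (mem_nNeg_iff _).1 hx
      replace hs := (mem_cartan_iff _).1 hs
      replace ht := (mem_nPos_iff _).1 ht
      rw [Submodule.mem_bot]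
      ext i
      · rcases lt_or_ge i 0 with h | h
        · simp [hs i h.ne, ht.1 i h.le]
        · exact hx.1 i h
      · exact hx.2
    · refine disjoint_iff_inf_le.2 ?_
      rintro x ⟨hx, hx'⟩
      obtain ⟨s, hs, t, ht, rfl⟩ := Submodule.mem_sup.1 hx'
      replace hx := (mem_cartan_iff _).1 hx
      replace hs := (mem_nNeg_iff _).1 hs
      replace ht := (mem_nPos_iff _).1 ht
      rw [Submodule.mem_bot]
      ext i
      · by_cases h : i = 0
        · subst h
          simp [hs.1 0 le_rfl, ht.1 0 le_rfl]
        · exact hx i h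
      · simp [hs.2, ht.2]
    · refine disjoint_iff_inf_le.2 ?_
      rintro x ⟨hx, hx'⟩
      obtain ⟨s, hs, t, ht, rfl⟩ := Submodule.mem_sup.1 hx'
      replace hx := (mem_nPos_iff _).1 hx
      replace hs := (mem_nNeg_iff _).1 hs
      replace ht := (mem_cartan_iff _).1 ht
      rw [Submodule.mem_bot]
      ext i
      · rcases le_or_gt i 0 with h | h
        · exact hx.1 i h
        · simp [hs.1 i h.le, ht i h.ne']
      · exact hx.2
  · rw [eq_top_iff]
    rintro x -
    have e1 : x = ⟨x.coeff.filter (· < 0), 0⟩ + (⟨x.coeff.filter (· = 0), x.central⟩ +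
        ⟨x.coeff.filter (0 < ·), 0⟩) := by
      ext i
      · simp only [coeff_add, Finsupp.add_apply, Finsupp.filter_apply]
        rcases lt_trichotomy i 0 with h | h | h
        · simp [h, h.ne, h.not_gt]
        · simp [h]
        · simp [h, h.ne', h.not_gt]
      · simp
    rw [e1]
    refine add_mem ?_ (add_mem ?_ ?_)
    · refine Submodule.mem_iSup_of_mem (0 : Fin 3) ((mem_nNeg_iff _).2 ⟨fun i hi => ?_, rfl⟩)
      exact Finsupp.filter_apply_neg _ _ hi.not_gt
    · refine Submodule.mem_iSup_of_mem (1 : Fin 3) ((mem_cartan_iff _).2 fun i hi => ?_)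
      exact Finsupp.filter_apply_neg _ _ hi
    · refine Submodule.mem_iSup_of_mem (2 : Fin 3) ((mem_nPos_iff _).2 ⟨fun i hi => ?_, rfl⟩)
      exact Finsupp.filter_apply_neg _ _ hi.not_gt

lemma eq_sum {x : Virasoro} (hx : x ∈ nPos) : x = x.coeff.sum fun i a => a • e i := by
  have hx2 : x.central = 0 := hx.2
  ext1
  · change _ = coeffₗ _
    rw [map_finsuppSum]
    have : ∀ (i : ℤ) (a : ℂ), coeffₗ (a • e i) = Finsupp.single i a := fun i a => by
      rw [map_smul]
      exact Finsupp.smul_single_one i a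
    simp only [this, Finsupp.sum_single]
  · rw [hx2]
    change _ = centralₗ _
    rw [map_finsuppSum]
    have : ∀ (i : ℤ) (a : ℂ), centralₗ (a • e i) = 0 := fun i a => by
      rw [map_smul]
      exact mul_zero a
    simp only [this, Finsupp.sum, Finset.sum_const_zero]

lemma weight_decomposition : nPos.toSubmodule =
    ⨆ α ∈ {α : Dual ℂ cartan | α ∈ AddSubmonoid.closure {simpleRoot} ∧ α ≠ 0},
      nPos.toSubmodule ⊓ adWeightSpace cartan α := by
  apply le_antisymm
  · intro x hx
    rw [eq_sum hx]
    refine Submodule.sum_mem _ fun i hi => Submodule.smul_mem _ _ ?_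
    have hi0 : 0 < i := hx.1 hi
    obtain ⟨n, rfl⟩ := Int.eq_ofNat_of_zero_le hi0.le
    have hne : n • simpleRoot ≠ 0 := by
      intro h
      have h1 : (n • simpleRoot) ⟨e 0, e_zero_mem_cartan⟩ = 0 := by
        rw [h, LinearMap.zero_apply]
      rw [LinearMap.smul_apply, simpleRoot_e_zero, nsmul_eq_mul, mul_one,
        Nat.cast_eq_zero] at h1
      omega
    have hcl : n • simpleRoot ∈ AddSubmonoid.closure {simpleRoot} :=
      nsmul_mem (AddSubmonoid.subset_closure (Set.mem_singleton _)) n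
    have hle := le_iSup₂ (f := fun (α : Dual ℂ cartan)
      (_ : α ∈ {α : Dual ℂ cartan | α ∈ AddSubmonoid.closure {simpleRoot} ∧ α ≠ 0}) =>
        nPos.toSubmodule ⊓ adWeightSpace cartan α) (n • simpleRoot) ⟨hcl, hne⟩
    exact hle (Submodule.mem_inf.2 ⟨e_mem_nPos hi0, e_mem_adWeightSpace n⟩)
  · exact iSup₂_le fun _ _ => inf_le_left

/-- The standard triangular decomposition of the Virasoro algebra. -/
def triangularDecomposition : TriangularDecomposition Virasoro where
  cartan := cartan
  nPos := nPos
  nNeg := nNeg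
  simpleRoots := {simpleRoot}
  sigma := sigma
  cartan_abelian := by
    intro x hx y hy
    ext1
    · rw [coeff_lie, cartan_eq hx, cartan_eq hy, wittBracket_single]
      simp
    · exact cocycle_eq_zero (by rintro i rfl j rfl; simp) hx hy
  linearIndependent := by
    rw [linearIndepOn_singleton_iff]
    intro h
    have h1 := simpleRoot_e_zero
    rw [show simpleRoot = 0 from h, LinearMap.zero_apply] at h1
    exact zero_ne_one h1
  weight_decomposition := weight_decomposition
  sigma_sigma := sigma_sigma
  sigma_lie := sigma_lie
  sigma_cartan := by
    intro x hx
    ext i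
    · rw [sigma_coeff]
      by_cases h : i = 0
      · simp [h]
      · rw [(mem_cartan_iff x).1 hx i h, (mem_cartan_iff x).1 hx (-i) (neg_ne_zero.2 h)]
    · rfl
  sigma_nPos := by
    have h1 : ∀ x ∈ nPos, sigma x ∈ nNeg := fun x hx => by
      rw [mem_nPos_iff] at hx
      exact (mem_nNeg_iff _).2 ⟨fun i hi => by rw [sigma_coeff]; exact hx.1 _ (by omega), hx.2⟩
    have h2 : ∀ x ∈ nNeg, sigma x ∈ nPos := fun x hx => by
      rw [mem_nNeg_iff] at hx
      exact (mem_nPos_iff _).2 ⟨fun i hi => by rw [sigma_coeff]; exact hx.1 _ (by omega), hx.2⟩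
    apply le_antisymm
    · rintro _ ⟨x, hx, rfl⟩
      exact h1 x hx
    · intro x hx
      exact ⟨sigma x, h2 x hx, sigma_sigma x⟩
  isInternal := isInternal

end Virasoro

end WhittakerPairs

end

universe u

open WhittakerPairs

/-!
A Whittaker vector of `N(-μ)*` is a linear form `f` on `N(-μ)` with `f (x u) = -λ(x) f u` for `x ∈
n₊`. As `g = n₊ ⊕ (h ⊕ n₋)`, the module `N(-μ)` is free of rank one over `U(n₊)`, so `f` is
determined by its value at the lowest weight vector, and that value is arbitrary. The freeness needs
no Poincaré-Birkhoff-Witt theorem: the left multiplication of `U(n₊)` on itself extends to an action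
of `g` for which `h ⊕ n₋` acts on `1` through a given character.

The simplicity of the image `L` of `M_λ` rests on the local nilpotency of the `n₊`-module `g / n₊`:
every `y ∈ g` is brought into `n₊` by iterated brackets with `n₊`, since these raise weights.
Consequently the operators `x - λ(x)`, `x ∈ n₊`, are jointly locally nilpotent on every quotient of
`M_λ`, so that each nonzero submodule of `L` contains a nonzero Whittaker vector. As `W_λ(L)` is a
line containing the image of the generator of `M_λ`, such a submodule is all of `L`. An eigenvector
of `n₊` with another character `χ` cannot exist either, because `x - λ(x)` acts on it by the scalar
`χ(x) - λ(x)`.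
-/

noncomputable section

namespace WhittakerPairs

open LieAlgebra Module UniversalEnvelopingAlgebra

attribute [local instance 100] LieRing.ofAssociativeRing

/-! ## Universal enveloping algebras and induced modules -/

section UniversalEnveloping

variable {R L : Type*} [CommRing R] [LieRing L] [LieAlgebra R L]

lemma adjoin_range_ι_eq_top :
    Algebra.adjoin R (Set.range (ι R : L → UniversalEnvelopingAlgebra R L)) = ⊤ := by
  set A := Algebra.adjoin R (Set.range (ι R : L → UniversalEnvelopingAlgebra R L))
  let f : L →ₗ⁅R⁆ A :=
    { toFun := fun x => ⟨ι R x, Algebra.subset_adjoin ⟨x, rfl⟩⟩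
      map_add' := fun x y => Subtype.ext (map_add _ x y)
      map_smul' := fun c x => Subtype.ext (map_smul _ c x)
      map_lie' := fun {x y} => Subtype.ext (LieHom.map_lie _ x y) }
  have retraction : A.val.comp (lift R f) = AlgHom.id R _ := by
    ext x
    exact congrArg A.val (lift_ι_apply R f x)
  refine Algebra.eq_top_iff.2 fun u => ?_
  rw [← AlgHom.id_apply (R := R) u, ← retraction]
  exact (lift R f u).2

lemma enveloping_induction {motive : UniversalEnvelopingAlgebra R L → Prop} (one : motive 1)
    (add : ∀ u v, motive u → motive v → motive (u + v))
    (smul : ∀ (c : R) u, motive u → motive (c • u))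
    (ι_mul : ∀ x u, motive u → motive (ι R x * u)) (u : UniversalEnvelopingAlgebra R L) :
    motive u := by
  suffices ∀ v, motive v → motive (u * v) by simpa only [mul_one] using this 1 one
  have hu : u ∈ Algebra.adjoin R (Set.range (ι R : L → UniversalEnvelopingAlgebra R L)) :=
    adjoin_range_ι_eq_top (R := R) (L := L) ▸ Algebra.mem_top
  induction hu using Algebra.adjoin_induction with
  | mem _ hx =>
    obtain ⟨x, rfl⟩ := hx
    exact ι_mul x
  | algebraMap c => simpa only [← Algebra.smul_def] using smul c
  | add a b _ _ ha hb =>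
    intro v hv
    rw [add_mul]
    exact add _ _ (ha v hv) (hb v hv)
  | mul a b _ _ ha hb =>
    intro v hv
    rw [mul_assoc]
    exact ha _ (hb v hv)

end UniversalEnveloping

namespace Induced

variable {g : Type u} [LieRing g] [LieAlgebra ℂ g] {p : LieSubalgebra ℂ g} {χ : LieCharacter ℂ p}

lemma lie_generator (x : p) : ⁅(x : g), generator p χ⁆ = χ x • generator p χ := by
  rw [lie_def, ← algebraMap_smul (UniversalEnvelopingAlgebra ℂ g) (χ x), ← sub_eq_zero,
    ← sub_smul]
  refine (Submodule.Quotient.mk_eq_zero _).2 ?_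
  change _ * 1 ∈ _
  rw [mul_one]
  exact Submodule.subset_span ⟨x, rfl⟩

lemma induction {motive : Induced p χ → Prop} (generator : motive (generator p χ))
    (add : ∀ m n, motive m → motive n → motive (m + n))
    (smul : ∀ (c : ℂ) m, motive m → motive (c • m))
    (lie : ∀ (x : g) m, motive m → motive ⁅x, m⁆) (m : Induced p χ) : motive m := by
  obtain ⟨u, rfl⟩ := Submodule.mkQ_surjective (inducedIdeal p χ) m
  induction u using enveloping_induction with
  | one => exact generator
  | add u v hu hv => exact add _ _ hu hv
  | smul c u hu => exact smul c _ hu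
  | ι_mul x u hu => exact lie x _ hu

variable {V : Type*} [AddCommGroup V] [Module ℂ V]

lemma lift_apply_eq_zero_of_mem_inducedIdeal {ρ : g →ₗ⁅ℂ⁆ Module.End ℂ V} {w : V}
    (hw : ∀ x : p, ρ x w = χ x • w) {u : UniversalEnvelopingAlgebra ℂ g}
    (hu : u ∈ inducedIdeal p χ) : UniversalEnvelopingAlgebra.lift ℂ ρ u w = 0 := by
  induction hu using Submodule.span_induction with
  | zero => rw [map_zero, LinearMap.zero_apply]
  | add a b _ _ ha hb => rw [map_add, LinearMap.add_apply, ha, hb, add_zero]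
  | smul a b _ hb => rw [smul_eq_mul, map_mul, Module.End.mul_apply, hb, map_zero]
  | mem a ha =>
    obtain ⟨x, rfl⟩ := ha
    rw [map_sub, LinearMap.sub_apply, lift_ι_apply, AlgHom.commutes, hw,
      Module.algebraMap_end_apply, sub_self]

/-- The linear map `u ⊗ v_χ ↦ u w` from the induced module to a representation `ρ`, where `p` acts
on `w` through `χ`. The action `ρ` is explicit, and not an instance, so that it can be an action on
an enveloping algebra other than the multiplication. -/
def lift (ρ : g →ₗ⁅ℂ⁆ Module.End ℂ V) (w : V) (hw : ∀ x : p, ρ x w = χ x • w) :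
    Induced p χ →ₗ[ℂ] V :=
  Submodule.liftQ ((inducedIdeal p χ).restrictScalars ℂ)
    (LinearMap.applyₗ w ∘ₗ (UniversalEnvelopingAlgebra.lift ℂ ρ).toLinearMap)
    (fun _ => lift_apply_eq_zero_of_mem_inducedIdeal hw)

section lift

variable (ρ : g →ₗ⁅ℂ⁆ Module.End ℂ V) (w : V) (hw : ∀ x : p, ρ x w = χ x • w)

@[simp] lemma lift_generator : lift ρ w hw (generator p χ) = w := by
  change UniversalEnvelopingAlgebra.lift ℂ ρ 1 w = w
  rw [map_one, Module.End.one_apply]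

@[simp] lemma lift_lie (x : g) (m : Induced p χ) : lift ρ w hw ⁅x, m⁆ = ρ x (lift ρ w hw m) := by
  obtain ⟨u, rfl⟩ := Submodule.mkQ_surjective (inducedIdeal p χ) m
  change UniversalEnvelopingAlgebra.lift ℂ ρ (ι ℂ x * u) w =
    ρ x (UniversalEnvelopingAlgebra.lift ℂ ρ u w)
  rw [map_mul, Module.End.mul_apply, lift_ι_apply]

end lift

section hom

variable [LieRingModule g V]

lemma hom_ext {φ ψ : Induced p χ →ₗ⁅ℂ,g⁆ V} (h : φ (generator p χ) = ψ (generator p χ)) :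
    φ = ψ := by
  ext m
  induction m using Induced.induction with
  | generator => exact h
  | add m n hm hn => rw [map_add, map_add, hm, hn]
  | smul c m hm => rw [map_smul, map_smul, hm]
  | lie x m hm => rw [LieModuleHom.map_lie, LieModuleHom.map_lie, hm]

lemma existsUnique_hom [LieModule ℂ g V] {w : V} (hw : ∀ x : p, ⁅(x : g), w⁆ = χ x • w) :
    ∃! φ : Induced p χ →ₗ⁅ℂ,g⁆ V, φ (generator p χ) = w :=
  have hw' (x : p) : LieModule.toEnd ℂ g V x w = χ x • w := hw x
  ⟨{ lift (LieModule.toEnd ℂ g V) w hw' with map_lie' := lift_lie _ w hw' _ _ },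
    lift_generator _ w hw', fun _ hψ => hom_ext (hψ.trans (lift_generator _ w hw').symm)⟩

end hom

end Induced

/-! ## Induction along a complementary subalgebra -/

section Complement

variable {R L : Type*} [CommRing R] [LieRing L] [LieAlgebra R L] {a b : LieSubalgebra R L}

/-- The action of a subalgebra `a` of `L` on the linear maps `L → U(a)` that comes from the left
multiplication on `U(a)` and the adjoint action on `L`. -/
def homAction (a : LieSubalgebra R L) :
    a →ₗ⁅R⁆ Module.End R (L →ₗ[R] UniversalEnvelopingAlgebra R a) where
  toFun x :=
    { toFun φ := LinearMap.mulLeft R (ι R x) ∘ₗ φ - φ ∘ₗ (ad R L x : L →ₗ[R] L)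
      map_add' φ ψ := by
        rw [LinearMap.comp_add, LinearMap.add_comp, add_sub_add_comm]
      map_smul' c φ := by
        rw [LinearMap.comp_smul, LinearMap.smul_comp, ← smul_sub, RingHom.id_apply] }
  map_add' x y := by
    ext φ z
    simp only [map_add, LinearMap.coe_mk, AddHom.coe_mk, LinearMap.sub_apply, LinearMap.comp_apply,
      LinearMap.mulLeft_apply, LinearMap.add_apply, ad_apply, AddMemClass.coe_add, add_mul]
    abel
  map_smul' c x := by
    ext φ z
    simp [smul_sub]
  map_lie' {x y} := by
    ext φ z
    simp only [LieHom.map_lie, LieRing.of_associative_ring_bracket, LieSubalgebra.coe_bracket,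
      LinearMap.coe_mk, AddHom.coe_mk, LinearMap.sub_apply, LinearMap.comp_apply,
      LinearMap.mulLeft_apply, Module.End.mul_apply, ad_apply, map_sub, sub_mul, mul_assoc]
    abel

lemma homAction_apply (x : a) (φ : L →ₗ[R] UniversalEnvelopingAlgebra R a) (y : L) :
    homAction a x φ y = ι R x * φ y - φ ⁅(x : L), y⁆ := rfl

variable (hab : IsCompl a.toSubmodule b.toSubmodule) (χ : LieCharacter R b)

/-- The map `y ↦ y • 1` for the action `inducedAction` of `L = a ⊕ b` on `U(a)`. -/
def inducedActionOne : L →ₗ[R] UniversalEnvelopingAlgebra R a :=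
  LinearMap.ofIsCompl hab (ι R (L := a)).toLinearMap (Algebra.linearMap R _ ∘ₗ χ.toLinearMap)

lemma inducedActionOne_left (x : a) : inducedActionOne hab χ x = ι R x :=
  LinearMap.ofIsCompl_apply_left hab x

lemma inducedActionOne_right (y : b) : inducedActionOne hab χ y = algebraMap R _ (χ y) :=
  LinearMap.ofIsCompl_apply_right hab y

/-- The map `u ↦ (y ↦ y • u)` for the action `inducedAction` of `L = a ⊕ b` on `U(a)`. The rule
`y • (x u) = x (y • u) - ⁅x, y⁆ • u` for `x ∈ a` says that this map is `a`-equivariant, so that its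
value at `1` determines it. -/
def inducedActionFlip :
    UniversalEnvelopingAlgebra R a →ₗ[R] L →ₗ[R] UniversalEnvelopingAlgebra R a :=
  LinearMap.applyₗ (inducedActionOne hab χ) ∘ₗ
    (UniversalEnvelopingAlgebra.lift R (homAction a)).toLinearMap

lemma inducedActionFlip_one : inducedActionFlip hab χ 1 = inducedActionOne hab χ := by
  change UniversalEnvelopingAlgebra.lift R (homAction a) 1 _ = _
  rw [map_one, Module.End.one_apply]

lemma inducedActionFlip_ι_mul (x : a) (u : UniversalEnvelopingAlgebra R a) (y : L) :
    inducedActionFlip hab χ (ι R x * u) y =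
      ι R x * inducedActionFlip hab χ u y - inducedActionFlip hab χ u ⁅(x : L), y⁆ := by
  change UniversalEnvelopingAlgebra.lift R (homAction a) (ι R x * u) _ y = _
  rw [map_mul, Module.End.mul_apply, lift_ι_apply]
  exact homAction_apply x _ y

lemma inducedActionFlip_left (u : UniversalEnvelopingAlgebra R a) (x : a) :
    inducedActionFlip hab χ u x = ι R x * u := by
  induction u using enveloping_induction generalizing x with
  | one => rw [inducedActionFlip_one, inducedActionOne_left, mul_one]
  | add u v hu hv => rw [map_add, LinearMap.add_apply, hu, hv, mul_add]
  | smul c u hu => rw [map_smul, LinearMap.smul_apply, hu, mul_smul_comm]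
  | ι_mul y u hu =>
    rw [inducedActionFlip_ι_mul, ← LieSubalgebra.coe_bracket, hu, hu, LieHom.map_lie,
      LieRing.of_associative_ring_bracket, sub_mul, mul_assoc, mul_assoc, sub_sub_cancel]

lemma inducedActionFlip_lie_left (u : UniversalEnvelopingAlgebra R a) (x : a) (z : L) :
    inducedActionFlip hab χ u ⁅(x : L), z⁆ =
      inducedActionFlip hab χ (inducedActionFlip hab χ u z) x -
        inducedActionFlip hab χ (inducedActionFlip hab χ u x) z := by
  rw [inducedActionFlip_left, inducedActionFlip_left, inducedActionFlip_ι_mul, sub_sub_cancel]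

lemma inducedActionFlip_one_lie_right (y z : b) :
    inducedActionFlip hab χ 1 ⁅(y : L), (z : L)⁆ =
      inducedActionFlip hab χ (inducedActionFlip hab χ 1 z) y -
        inducedActionFlip hab χ (inducedActionFlip hab χ 1 y) z := by
  have right_right (y z : b) : inducedActionFlip hab χ (inducedActionFlip hab χ 1 y) z =
      algebraMap R _ (χ y * χ z) := by
    rw [inducedActionFlip_one, inducedActionOne_right, Algebra.algebraMap_eq_smul_one, map_smul,
      LinearMap.smul_apply, inducedActionFlip_one, inducedActionOne_right, Algebra.smul_def,
      ← map_mul]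
  rw [right_right, right_right, mul_comm, sub_self, inducedActionFlip_one,
    ← LieSubalgebra.coe_bracket, inducedActionOne_right, lieCharacter_apply_lie, map_zero]

lemma inducedActionFlip_one_lie (y z : L) :
    inducedActionFlip hab χ 1 ⁅y, z⁆ =
      inducedActionFlip hab χ (inducedActionFlip hab χ 1 z) y -
        inducedActionFlip hab χ (inducedActionFlip hab χ 1 y) z := by
  obtain ⟨s, s', rfl, -⟩ := Submodule.existsUnique_add_of_isCompl hab y
  obtain ⟨t, t', rfl, -⟩ := Submodule.existsUnique_add_of_isCompl hab z
  have lie_left := inducedActionFlip_lie_left hab χ 1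
  have lie_right := inducedActionFlip_one_lie_right hab χ s' t'
  have left_swap : ⁅(s' : L), (t : L)⁆ = -⁅(t : L), (s' : L)⁆ := (lie_skew _ _).symm
  simp only [add_lie, lie_add, map_add, LinearMap.add_apply, map_neg, left_swap, lie_left,
    lie_right]
  abel

lemma inducedActionFlip_lie (u : UniversalEnvelopingAlgebra R a) (y z : L) :
    inducedActionFlip hab χ u ⁅y, z⁆ =
      inducedActionFlip hab χ (inducedActionFlip hab χ u z) y -
        inducedActionFlip hab χ (inducedActionFlip hab χ u y) z := by
  induction u using enveloping_induction generalizing y z with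
  | one => exact inducedActionFlip_one_lie hab χ y z
  | add u v hu hv => simp only [map_add, LinearMap.add_apply, hu, hv, add_sub_add_comm]
  | smul c u hu => simp only [map_smul, LinearMap.smul_apply, hu, smul_sub]
  | ι_mul x u hu =>
    simp only [inducedActionFlip_ι_mul, leibniz_lie (x : L) y z, map_add, map_sub,
      LinearMap.sub_apply, hu, mul_sub]
    abel

/-- The action of `L = a ⊕ b` on `U(a)` that extends the left multiplication by `a` and for which
`b` acts on `1` through `χ`. -/
def inducedAction : L →ₗ⁅R⁆ Module.End R (UniversalEnvelopingAlgebra R a) where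
  __ := (inducedActionFlip hab χ).flip
  map_lie' {y z} := LinearMap.ext fun u => inducedActionFlip_lie hab χ u y z

lemma inducedAction_left (x : a) (u : UniversalEnvelopingAlgebra R a) :
    inducedAction hab χ x u = ι R x * u :=
  inducedActionFlip_left hab χ u x

lemma inducedAction_right_one (y : b) : inducedAction hab χ y 1 = χ y • 1 := by
  change inducedActionFlip hab χ 1 y = _
  rw [inducedActionFlip_one, inducedActionOne_right, Algebra.algebraMap_eq_smul_one]

lemma inducedAction_ι_mul (y : L) (x : a) (u : UniversalEnvelopingAlgebra R a) :
    inducedAction hab χ y (ι R x * u) =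
      ι R x * inducedAction hab χ y u - inducedAction hab χ ⁅(x : L), y⁆ u :=
  inducedActionFlip_ι_mul hab χ x u y

end Complement

namespace Induced

variable {g : Type u} [LieRing g] [LieAlgebra ℂ g] {a b : LieSubalgebra ℂ g}

/-- The map `U(a) → U(g) ⊗_{U(b)} ℂ_χ`, `u ↦ u ⊗ v_χ`, for a further subalgebra `a`. -/
def ofEnveloping (a : LieSubalgebra ℂ g) (χ : LieCharacter ℂ b) :
    UniversalEnvelopingAlgebra ℂ a →ₗ[ℂ] Induced b χ :=
  LinearMap.applyₗ (generator b χ) ∘ₗ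
    (UniversalEnvelopingAlgebra.lift ℂ (LieModule.toEnd ℂ a (Induced b χ))).toLinearMap

@[simp] lemma ofEnveloping_one (χ : LieCharacter ℂ b) : ofEnveloping a χ 1 = generator b χ := by
  simp [ofEnveloping]

lemma ofEnveloping_ι_mul (χ : LieCharacter ℂ b) (x : a) (u : UniversalEnvelopingAlgebra ℂ a) :
    ofEnveloping a χ (ι ℂ x * u) = ⁅(x : g), ofEnveloping a χ u⁆ := by
  simp only [ofEnveloping, LinearMap.comp_apply, AlgHom.toLinearMap_apply, map_mul, lift_ι_apply,
    LinearMap.applyₗ_apply_apply, Module.End.mul_apply]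
  rfl

variable (hab : IsCompl a.toSubmodule b.toSubmodule) (χ : LieCharacter ℂ b)

lemma ofEnveloping_inducedAction (y : g) (u : UniversalEnvelopingAlgebra ℂ a) :
    ofEnveloping a χ (inducedAction hab χ y u) = ⁅y, ofEnveloping a χ u⁆ := by
  induction u using enveloping_induction generalizing y with
  | one =>
    obtain ⟨s, t, rfl, -⟩ := Submodule.existsUnique_add_of_isCompl hab y
    rw [map_add, LinearMap.add_apply, inducedAction_left, inducedAction_right_one, map_add,
      ofEnveloping_ι_mul, map_smul, ofEnveloping_one, add_lie]
    exact congrArg _ (lie_generator t).symm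
  | add u v hu hv => rw [map_add, map_add, hu, hv, map_add, lie_add]
  | smul c u hu => rw [map_smul, map_smul, hu, map_smul, lie_smul]
  | ι_mul x u hu =>
    rw [inducedAction_ι_mul, map_sub, ofEnveloping_ι_mul, hu, hu, ofEnveloping_ι_mul, lie_lie,
      sub_sub_cancel]

/-- For `g = a ⊕ b` the module induced from a character of `b` is, as an `a`-module, `U(a)`. -/
def equivEnveloping : Induced b χ ≃ₗ[ℂ] UniversalEnvelopingAlgebra ℂ a :=
  LinearEquiv.ofLinearMap (lift (inducedAction hab χ) 1 (inducedAction_right_one hab χ))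
    (ofEnveloping a χ)
    (LinearMap.ext fun u => by
      induction u using enveloping_induction with
      | one => simp
      | add u v hu hv => rw [map_add, hu, hv, map_add]
      | smul c u hu => rw [map_smul, hu, map_smul]
      | ι_mul x u hu =>
        rw [LinearMap.comp_apply, LinearMap.id_apply] at hu ⊢
        rw [ofEnveloping_ι_mul, lift_lie, hu, inducedAction_left])
    (LinearMap.ext fun m => by
      induction m using Induced.induction with
      | generator => simp
      | add m n hm hn => rw [map_add, hm, hn, map_add]
      | smul c m hm => rw [map_smul, hm, map_smul]
      | lie x m hm =>
        rw [LinearMap.comp_apply, LinearMap.id_apply] at hm ⊢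
        rw [lift_lie, ofEnveloping_inducedAction, hm])

lemma equivEnveloping_generator : equivEnveloping hab χ (generator b χ) = 1 :=
  lift_generator _ _ (inducedAction_right_one hab χ)

lemma equivEnveloping_lie (x : a) (m : Induced b χ) :
    equivEnveloping hab χ ⁅(x : g), m⁆ = ι ℂ x * equivEnveloping hab χ m :=
  (lift_lie _ _ (inducedAction_right_one hab χ) _ _).trans (inducedAction_left hab χ x _)

variable {χ}

lemma induction_of_isCompl (hab : IsCompl a.toSubmodule b.toSubmodule)
    {motive : Induced b χ → Prop} (generator : motive (generator b χ))
    (add : ∀ m n, motive m → motive n → motive (m + n))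
    (smul : ∀ (c : ℂ) m, motive m → motive (c • m))
    (lie : ∀ (x : a) m, motive m → motive ⁅(x : g), m⁆) (m : Induced b χ) : motive m := by
  obtain ⟨u, rfl⟩ := (equivEnveloping hab χ).symm.surjective m
  change motive (ofEnveloping a χ u)
  induction u using enveloping_induction with
  | one => simpa using generator
  | add u v hu hv => simpa only [map_add] using add _ _ hu hv
  | smul c u hu => simpa only [map_smul] using smul c _ hu
  | ι_mul x u hu => simpa only [ofEnveloping_ι_mul] using lie x _ hu

lemma existsUnique_dual (hab : IsCompl a.toSubmodule b.toSubmodule) (lam : LieCharacter ℂ a)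
    (c : ℂ) :
    ∃! f : Dual ℂ (Induced b χ),
      f (generator b χ) = c ∧ ∀ (x : a) (m : Induced b χ), f ⁅(x : g), m⁆ = lam x * f m := by
  refine existsUnique_of_exists_of_unique
    ⟨c • (UniversalEnvelopingAlgebra.lift ℂ lam).toLinearMap ∘ₗ
      (equivEnveloping hab χ).toLinearMap, ?_, fun x m => ?_⟩ ?_
  · simp [equivEnveloping_generator]
  · simp [equivEnveloping_lie, mul_left_comm]
  · rintro f f' ⟨f_generator, f_lie⟩ ⟨f'_generator, f'_lie⟩
    ext m
    induction m using induction_of_isCompl hab with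
    | generator => rw [f_generator, f'_generator]
    | add m n hm hn => rw [map_add, map_add, hm, hn]
    | smul c m hm => rw [map_smul, map_smul, hm]
    | lie x m hm => rw [f_lie, f'_lie, hm]

end Induced

/-- The character `-χ`. For `f` in a dual module, `x f = χ(x) f` means `f (x v) = -χ(x) f v`, so
that Whittaker vectors of type `χ` are the linear forms that transform through `-χ`. -/
def negCharacter {R L : Type*} [CommRing R] [LieRing L] [LieAlgebra R L] (χ : LieCharacter R L) :
    LieCharacter R L where
  __ := -χ.toLinearMap
  map_lie' {x y} := by
    change -χ ⁅x, y⁆ = ⁅-χ x, -χ y⁆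
    rw [lieCharacter_apply_lie, neg_zero, LieRing.of_associative_ring_bracket, mul_comm, sub_self]

namespace TriangularDecomposition

variable {g : Type u} [LieRing g] [LieAlgebra ℂ g] (D : TriangularDecomposition g)

lemma isCompl_nPos_borelNeg : IsCompl D.nPos.toSubmodule D.borelNeg.toSubmodule := by
  have borelNeg_eq : D.borelNeg.toSubmodule = ⨆ i ∈ ({1, 0} : Set (Fin 3)),
      ![D.nNeg.toSubmodule, D.cartan.toSubmodule, D.nPos.toSubmodule] i := by
    rw [iSup_insert, iSup_singleton]
    rfl
  refine ⟨borelNeg_eq ▸ D.isInternal.submodule_iSupIndep.disjoint_biSup (x := 2) (by simp),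
    codisjoint_iff_le_sup.2 ?_⟩
  rw [← D.isInternal.submodule_iSup_eq_top, iSup_le_iff, Fin.forall_fin_succ, Fin.forall_fin_two]
  exact ⟨le_sup_of_le_right le_sup_right, le_sup_of_le_right le_sup_left, le_sup_left⟩

lemma mem_whittakerSpace_dual {V : Type*} [AddCommGroup V] [Module ℂ V] [LieRingModule g V]
    [LieModule ℂ g V] {lam : LieCharacter ℂ D.nPos} {f : Dual ℂ V} :
    f ∈ D.whittakerSpace (Dual ℂ V) lam ↔
      ∀ (x : D.nPos) v, f ⁅(x : g), v⁆ = negCharacter lam x * f v := by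
  refine forall_congr' fun x => LinearMap.ext_iff.trans (forall_congr' fun v => ?_)
  change -f ⁅(x : g), v⁆ = lam x * f v ↔ f ⁅(x : g), v⁆ = -lam x * f v
  rw [neg_mul, neg_eq_iff_eq_neg]

theorem finrank_whittakerSpace_dual_lowestVerma (lam : LieCharacter ℂ D.nPos)
    (μ : Dual ℂ D.cartan) :
    finrank ℂ (D.whittakerSpace (Dual ℂ (D.LowestVerma μ)) lam) = 1 := by
  have existsUnique (c : ℂ) : ∃! f : Dual ℂ (D.LowestVerma μ),
      f (Induced.generator _ _) = c ∧ f ∈ D.whittakerSpace (Dual ℂ (D.LowestVerma μ)) lam := by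
    simpa only [mem_whittakerSpace_dual] using
      Induced.existsUnique_dual D.isCompl_nPos_borelNeg (negCharacter lam) c
  obtain ⟨f, ⟨f_generator, hf⟩, -⟩ := existsUnique 1
  refine finrank_eq_one ⟨f, hf⟩ (fun h => ?_) fun ⟨f', hf'⟩ =>
    ⟨f' (Induced.generator _ _), Subtype.ext ((existsUnique _).unique ⟨?_, ?_⟩ ⟨rfl, hf'⟩)⟩
  · obtain rfl : f = 0 := congrArg Subtype.val h
    exact zero_ne_one f_generator
  · change _ * f (Induced.generator _ _) = _
    rw [f_generator, mul_one]
  · exact Submodule.smul_mem _ _ hf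

end TriangularDecomposition

/-! ## Local nilpotency of `n₊` on `g / n₊` -/

section AdWeightSpace

variable {g : Type u} [LieRing g] [LieAlgebra ℂ g] {h : LieSubalgebra ℂ g}

lemma iSupIndep_adWeightSpace [IsLieAbelian h] : iSupIndep (adWeightSpace h) := by
  have weightSpace_eq (α : Dual ℂ h) :
      adWeightSpace h α = (LieModule.weightSpace g (α : h → ℂ)).toSubmodule := by
    ext x
    exact (LieModule.mem_weightSpace _ _).symm
  have h_ind := ((LieModule.iSupIndep_genWeightSpace ℂ h g).mono
    (LieModule.weightSpace_le_genWeightSpace g)).comp (DFunLike.coe_injective (F := Dual ℂ h))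
  rw [← LieSubmodule.iSupIndep_toSubmodule] at h_ind
  rwa [funext weightSpace_eq]

lemma lie_mem_adWeightSpace {α β : Dual ℂ h} {x y : g} (hx : x ∈ adWeightSpace h α)
    (hy : y ∈ adWeightSpace h β) : ⁅x, y⁆ ∈ adWeightSpace h (α + β) := by
  intro t
  rw [leibniz_lie, hx t, hy t, smul_lie, lie_smul, ← add_smul, LinearMap.add_apply]

end AdWeightSpace

namespace TriangularDecomposition

variable {g : Type u} [LieRing g] [LieAlgebra ℂ g] (D : TriangularDecomposition g)

/-- A linear form on `h*` equal to `1` on all simple roots, so that it gives the height of the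
elements of the root monoid `Q₊`; its values on a complement of the span of `Π` are arbitrary. -/
def height : Dual ℂ (Dual ℂ D.cartan) :=
  (Basis.extend D.linearIndependent).constr ℂ fun _ => (1 : ℂ)

lemma height_of_mem_simpleRoots {α : Dual ℂ D.cartan} (hα : α ∈ D.simpleRoots) :
    D.height α = 1 := by
  simpa only [height, Basis.extend_apply_self] using
    (Basis.extend D.linearIndependent).constr_basis ℂ (fun _ => (1 : ℂ))
      ⟨α, Basis.subset_extend D.linearIndependent hα⟩

lemma exists_height_eq_natCast {α : Dual ℂ D.cartan}
    (hα : α ∈ AddSubmonoid.closure D.simpleRoots) : ∃ k : ℕ, D.height α = k ∧ (k = 0 → α = 0) := by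
  induction hα using AddSubmonoid.closure_induction with
  | mem α hα => exact ⟨1, by rw [D.height_of_mem_simpleRoots hα, Nat.cast_one], by simp⟩
  | zero => exact ⟨0, by simp⟩
  | add α β _ _ hα hβ =>
    obtain ⟨k, hk, hk₀⟩ := hα
    obtain ⟨l, hl, hl₀⟩ := hβ
    refine ⟨k + l, by rw [map_add, hk, hl, Nat.cast_add], fun h => ?_⟩
    obtain ⟨hk', hl'⟩ := add_eq_zero.1 h
    rw [hk₀ hk', hl₀ hl', add_zero]

/-- The sum of the root spaces whose height lies in a set `s` of integers. -/
def heightSpace (s : Set ℤ) : Submodule ℂ g :=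
  ⨆ α ∈ {α | ∃ k ∈ s, D.height α = (k : ℤ)}, adWeightSpace D.cartan α

variable {D} in
lemma adWeightSpace_le_heightSpace {s : Set ℤ} {α : Dual ℂ D.cartan} {k : ℤ} (hk : k ∈ s)
    (hα : D.height α = k) : adWeightSpace D.cartan α ≤ D.heightSpace s :=
  le_biSup (adWeightSpace D.cartan) (Set.mem_ofPred.2 ⟨k, hk, hα⟩)

lemma heightSpace_mono {s t : Set ℤ} (h : s ⊆ t) : D.heightSpace s ≤ D.heightSpace t :=
  biSup_mono fun _ ⟨k, hk, hα⟩ => ⟨k, h hk, hα⟩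

lemma disjoint_heightSpace {s t : Set ℤ} (h : Disjoint s t) :
    Disjoint (D.heightSpace s) (D.heightSpace t) := by
  have : IsLieAbelian D.cartan := ⟨fun x y => Subtype.ext (D.cartan_abelian x x.2 y y.2)⟩
  refine iSupIndep_adWeightSpace.disjoint_biSup_biSup (Set.disjoint_left.2 ?_)
  rintro α ⟨k, hk, hαk⟩ ⟨l, hl, hαl⟩
  obtain rfl : k = l := Int.cast_injective (hαk.symm.trans hαl)
  exact h.notMem_of_mem_left hk hl

lemma nPos_le {N : Submodule ℂ g} (h : ∀ (α : Dual ℂ D.cartan) (k : ℕ), 0 < k → D.height α = k →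
    adWeightSpace D.cartan α ≤ N) : D.nPos.toSubmodule ≤ N := by
  rw [D.weight_decomposition]
  refine iSup₂_le fun α ⟨hα, hα₀⟩ => inf_le_right.trans ?_
  obtain ⟨k, hk, hk₀⟩ := D.exists_height_eq_natCast hα
  exact h α k (Nat.pos_of_ne_zero fun hk' => hα₀ (hk₀ hk')) hk

lemma sigma_mem_adWeightSpace {α : Dual ℂ D.cartan} {x : g} (hx : x ∈ adWeightSpace D.cartan α) :
    D.sigma x ∈ adWeightSpace D.cartan (-α) := by
  intro t
  rw [← D.sigma_cartan t t.2, ← D.sigma_lie, ← lie_skew, hx t, map_neg, map_smul,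
    LinearMap.neg_apply, neg_smul]

lemma nPos_le_heightSpace : D.nPos.toSubmodule ≤ D.heightSpace (Set.Ioi 0) :=
  D.nPos_le fun _ k hk hα =>
    adWeightSpace_le_heightSpace (k := k) (Int.natCast_pos.2 hk) (by rw [hα, Int.cast_natCast])

lemma borelNeg_le_heightSpace : D.borelNeg.toSubmodule ≤ D.heightSpace (Set.Iic 0) := by
  change D.cartan.toSubmodule ⊔ D.nNeg.toSubmodule ≤ _
  refine sup_le ?_ ?_
  · intro x hx
    have hx₀ : x ∈ adWeightSpace D.cartan 0 := fun t => by
      rw [D.cartan_abelian t t.2 x hx, LinearMap.zero_apply, zero_smul]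
    exact adWeightSpace_le_heightSpace (k := 0) (Set.mem_Iic.2 le_rfl) (by simp) hx₀
  · rw [← D.sigma_nPos, Submodule.map_le_iff_le_comap]
    exact D.nPos_le fun α k _ hα x hx => adWeightSpace_le_heightSpace (k := -k) (by simp)
      (by rw [map_neg, hα, Int.cast_neg, Int.cast_natCast]) (D.sigma_mem_adWeightSpace hx)

lemma heightSpace_Ioi_zero : D.heightSpace (Set.Ioi 0) = D.nPos.toSubmodule := by
  have disjoint := D.disjoint_heightSpace (Set.Iic_disjoint_Ioi (le_refl (0 : ℤ)))
  refine (eq_of_le_of_inf_le_of_le_sup (z := D.borelNeg.toSubmodule)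
    D.nPos_le_heightSpace ?_ ?_).symm
  · exact (disjoint.symm.mono_right D.borelNeg_le_heightSpace).le_bot.trans bot_le
  · rw [D.isCompl_nPos_borelNeg.sup_eq_top]
    exact le_top

lemma heightSpace_univ : D.heightSpace Set.univ = ⊤ := by
  rw [eq_top_iff, ← D.isCompl_nPos_borelNeg.sup_eq_top]
  exact sup_le (D.nPos_le_heightSpace.trans (D.heightSpace_mono (Set.subset_univ _)))
    (D.borelNeg_le_heightSpace.trans (D.heightSpace_mono (Set.subset_univ _)))

lemma adWeightSpace_le_ucs {d : ℕ} {α : Dual ℂ D.cartan} {k : ℤ} (hk : 0 < k + d)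
    (hα : D.height α = k) :
    adWeightSpace D.cartan α ≤ (D.nPos.toLieSubmodule.ucs d).toSubmodule := by
  induction d generalizing α k with
  | zero =>
    rw [LieSubmodule.ucs_zero, LieSubalgebra.coe_toLieSubmodule, ← heightSpace_Ioi_zero]
    exact adWeightSpace_le_heightSpace (by simpa using hk) hα
  | succ d ih =>
    intro y hy
    rw [LieSubmodule.ucs_succ]
    refine (LieSubmodule.mem_normalizer _ _).2 fun ⟨x, hx⟩ => ?_
    suffices D.nPos.toSubmodule ≤ (D.nPos.toLieSubmodule.ucs d).toSubmodule.comap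
        ((LieModule.toEnd ℂ g g).toLinearMap.flip y) from this hx
    refine D.nPos_le fun β l hl hβ x hx => ih (α := β + α) (k := l + k) ?_ ?_
      (lie_mem_adWeightSpace hx hy)
    · omega
    · rw [map_add, hα, hβ, Int.cast_add, Int.cast_natCast]

theorem exists_mem_ucs (y : g) : ∃ d, y ∈ D.nPos.toLieSubmodule.ucs d := by
  have ucs_mono : Monotone fun d => (D.nPos.toLieSubmodule.ucs d).toSubmodule :=
    monotone_nat_of_le_succ fun d => by
      rw [LieSubmodule.ucs_succ]
      exact LieSubmodule.le_normalizer _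
  suffices (⊤ : Submodule ℂ g) ≤ ⨆ d, (D.nPos.toLieSubmodule.ucs d).toSubmodule from
    (Submodule.mem_iSup_of_directed _ ucs_mono.directed_le).1 (this Submodule.mem_top)
  rw [← D.heightSpace_univ]
  refine iSup₂_le fun α ⟨k, _, hα⟩ => ?_
  exact le_iSup_of_le (1 - k).toNat (D.adWeightSpace_le_ucs (by omega) hα)

end TriangularDecomposition

/-! ## Generalized Whittaker vectors -/

section Filtration

variable {R L : Type*} [CommRing R] [LieRing L] [LieAlgebra R L] {n : LieSubalgebra R L}
  (χ : LieCharacter R n)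
variable (V : Type*) [AddCommGroup V] [Module R V] [LieRingModule L V] [LieModule R L V]

/-- The filtration of a Lie module by the subspaces `F_k` of generalized Whittaker vectors, those
annihilated by all products of `k` operators `x - χ x` with `x ∈ n`. -/
def whittakerFiltration : ℕ → Submodule R V
  | 0 => ⊥
  | k + 1 => ⨅ x : n,
      (whittakerFiltration k).comap (LieModule.toEnd R L V x - χ x • LinearMap.id)

variable {V}

@[simp] lemma mem_whittakerFiltration_zero {w : V} : w ∈ whittakerFiltration χ V 0 ↔ w = 0 :=
  Submodule.mem_bot R

lemma mem_whittakerFiltration_succ {k : ℕ} {w : V} :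
    w ∈ whittakerFiltration χ V (k + 1) ↔
      ∀ x : n, ⁅(x : L), w⁆ - χ x • w ∈ whittakerFiltration χ V k := by
  simp [whittakerFiltration]

variable (V) in
lemma whittakerFiltration_mono : Monotone (whittakerFiltration χ V) := by
  refine monotone_nat_of_le_succ fun k => ?_
  induction k with
  | zero => exact bot_le
  | succ k ih =>
    intro w hw
    rw [mem_whittakerFiltration_succ] at hw ⊢
    exact fun x => ih (hw x)

variable {χ}

lemma lie_mem_whittakerFiltration {d k : ℕ} {y : L} {w : V} (hy : y ∈ n.toLieSubmodule.ucs d)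
    (hw : w ∈ whittakerFiltration χ V k) : ⁅y, w⁆ ∈ whittakerFiltration χ V (k + d) := by
  induction d generalizing y k w with
  | zero =>
    cases k with
    | zero => simp_all
    | succ k =>
      have h := whittakerFiltration_mono χ V k.le_succ
        ((mem_whittakerFiltration_succ χ).1 hw ⟨y, hy⟩)
      exact (Submodule.sub_mem_iff_left _ (Submodule.smul_mem _ _ hw)).1 h
  | succ d ih_d =>
    rw [LieSubmodule.ucs_succ, LieSubmodule.mem_normalizer] at hy
    induction k generalizing w with
    | zero => simp_all
    | succ k ih_k =>
      rw [← add_assoc, mem_whittakerFiltration_succ]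
      intro x
      have commute : ⁅(x : L), ⁅y, w⁆⁆ - χ x • ⁅y, w⁆ =
          ⁅⁅(x : L), y⁆, w⁆ + ⁅y, ⁅(x : L), w⁆ - χ x • w⁆ := by
        rw [leibniz_lie, lie_sub, lie_smul, add_sub_assoc]
      rw [commute]
      refine add_mem (ih_d (hy x) hw) ?_
      simpa only [add_assoc, add_comm 1 d] using ih_k ((mem_whittakerFiltration_succ χ).1 hw x)

lemma exists_whittakerVector_mem {N : Submodule R V} (hN : ∀ x : n, ∀ w ∈ N, ⁅(x : L), w⁆ ∈ N)
    {k : ℕ} {w : V} (hwk : w ∈ whittakerFiltration χ V k) (hwN : w ∈ N) (hw : w ≠ 0) :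
    ∃ v ∈ N, v ≠ 0 ∧ ∀ x : n, ⁅(x : L), v⁆ = χ x • v := by
  induction k generalizing w with
  | zero => exact absurd ((mem_whittakerFiltration_zero χ).1 hwk) hw
  | succ k ih =>
    by_cases! h : ∀ x : n, ⁅(x : L), w⁆ = χ x • w
    · exact ⟨w, hwN, hw, h⟩
    · obtain ⟨x, hx⟩ := h
      exact ih ((mem_whittakerFiltration_succ χ).1 hwk x)
        (sub_mem (hN x w hwN) (N.smul_mem _ hwN)) (sub_ne_zero.2 hx)

end Filtration

lemma Induced.exists_mem_whittakerFiltration {g : Type u} [LieRing g] [LieAlgebra ℂ g]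
    {n : LieSubalgebra ℂ g} {χ : LieCharacter ℂ n} {V : Type*} [AddCommGroup V] [Module ℂ V]
    [LieRingModule g V] [LieModule ℂ g V] (hn : ∀ y : g, ∃ d, y ∈ n.toLieSubmodule.ucs d)
    (φ : Induced n χ →ₗ⁅ℂ,g⁆ V) (m : Induced n χ) : ∃ k, φ m ∈ whittakerFiltration χ V k := by
  induction m using Induced.induction with
  | generator =>
    refine ⟨1, (mem_whittakerFiltration_succ χ).2 fun x => ?_⟩
    rw [← LieModuleHom.map_lie, Induced.lie_generator, map_smul, sub_self]
    exact zero_mem _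
  | add m m' hm hm' =>
    obtain ⟨k, hk⟩ := hm
    obtain ⟨k', hk'⟩ := hm'
    refine ⟨max k k', ?_⟩
    rw [map_add]
    exact add_mem (whittakerFiltration_mono χ V (le_max_left _ _) hk)
      (whittakerFiltration_mono χ V (le_max_right _ _) hk')
  | smul c m hm =>
    obtain ⟨k, hk⟩ := hm
    exact ⟨k, by rw [map_smul]; exact Submodule.smul_mem _ _ hk⟩
  | lie y m hm =>
    obtain ⟨k, hk⟩ := hm
    obtain ⟨d, hd⟩ := hn y
    exact ⟨k + d, by rw [LieModuleHom.map_lie]; exact lie_mem_whittakerFiltration hd hk⟩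

/-! ## Quotients of the standard Whittaker module -/

section RangeRestrict

variable {R L M N : Type*} [CommRing R] [LieRing L] [AddCommGroup M] [Module R M]
  [LieRingModule L M] [AddCommGroup N] [Module R N] [LieRingModule L N]

/-- A homomorphism of Lie modules as a map onto its image. -/
def rangeRestrict (φ : M →ₗ⁅R,L⁆ N) : M →ₗ⁅R,L⁆ φ.range :=
  φ.codRestrict φ.range φ.mem_range_self

lemma rangeRestrict_surjective (φ : M →ₗ⁅R,L⁆ N) : Function.Surjective (rangeRestrict φ) :=
  LinearMap.surjective_rangeRestrict φ.toLinearMap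

end RangeRestrict

namespace TriangularDecomposition

variable {g : Type u} [LieRing g] [LieAlgebra ℂ g] (D : TriangularDecomposition g)
  {lam : LieCharacter ℂ D.nPos}
variable {V : Type*} [AddCommGroup V] [Module ℂ V] [LieRingModule g V] [LieModule ℂ g V]

lemma map_generator_mem_whittakerSpace (φ : D.StandardWhittaker lam →ₗ⁅ℂ,g⁆ V) :
    φ (Induced.generator D.nPos lam) ∈ D.whittakerSpace V lam := by
  intro x
  rw [← LieModuleHom.map_lie, Induced.lie_generator, map_smul]

omit [LieModule ℂ g V] in
lemma map_generator_ne_zero {φ : D.StandardWhittaker lam →ₗ⁅ℂ,g⁆ V} (hφ : φ ≠ 0) :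
    φ (Induced.generator D.nPos lam) ≠ 0 :=
  fun h => hφ (Induced.hom_ext (by rw [h, LieModuleHom.zero_apply]))

lemma exists_mem_whittakerSpace_ne_zero {φ : D.StandardWhittaker lam →ₗ⁅ℂ,g⁆ V}
    (hφ : Function.Surjective φ) {N : Submodule ℂ V}
    (hN : ∀ x : D.nPos, ∀ w ∈ N, ⁅(x : g), w⁆ ∈ N) (hN₀ : N ≠ ⊥) :
    ∃ w ∈ N, w ≠ 0 ∧ w ∈ D.whittakerSpace V lam := by
  obtain ⟨w, hwN, hw⟩ := N.ne_bot_iff.1 hN₀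
  obtain ⟨m, rfl⟩ := hφ w
  obtain ⟨k, hk⟩ := Induced.exists_mem_whittakerFiltration D.exists_mem_ucs φ m
  exact exists_whittakerVector_mem hN hk hwN hw

theorem isIrreducible_of_surjective {φ : D.StandardWhittaker lam →ₗ⁅ℂ,g⁆ V}
    (hφ : Function.Surjective φ) (hV : finrank ℂ (D.whittakerSpace V lam) = 1) :
    LieModule.IsIrreducible ℂ g V := by
  have : Nontrivial (D.whittakerSpace V lam) := nontrivial_of_finrank_eq_succ hV
  have : Nontrivial V := (D.whittakerSpace V lam).subtype_injective.nontrivial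
  refine .mk fun N hN => ?_
  obtain ⟨w, hwN, hw, hwW⟩ := D.exists_mem_whittakerSpace_ne_zero hφ
    (fun x w hw => N.lie_mem hw) (fun h => hN ((LieSubmodule.toSubmodule_eq_bot N).1 h))
  have whittakerSpace_le : D.whittakerSpace V lam ≤ N.toSubmodule := by
    rw [eq_span_singleton_of_mem_of_finrank_eq_one hV hwW hw]
    exact (Submodule.span_singleton_le_iff_mem _ _).2 hwN
  rw [eq_top_iff]
  rintro v -
  obtain ⟨m, rfl⟩ := hφ v
  induction m using Induced.induction with
  | generator => exact whittakerSpace_le (D.map_generator_mem_whittakerSpace φ)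
  | add m m' hm hm' => rw [map_add]; exact add_mem hm hm'
  | smul c m hm => rw [map_smul]; exact N.smul_mem c hm
  | lie y m hm => rw [LieModuleHom.map_lie]; exact N.lie_mem hm

variable (V) in
lemma whittakerSpace_subset_whittakerVectors :
    (D.whittakerSpace V lam : Set V) ⊆ D.whittakerVectors V := fun w hw x =>
  hw x ▸ Submodule.smul_mem _ _ (Submodule.mem_span_singleton_self w)

lemma lie_mem_span_singleton {w : V} (hw : w ∈ D.whittakerVectors V) (x : D.nPos) {v : V}
    (hv : v ∈ Submodule.span ℂ {w}) : ⁅(x : g), v⁆ ∈ Submodule.span ℂ {w} := by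
  obtain ⟨c, rfl⟩ := Submodule.mem_span_singleton.1 hv
  rw [lie_smul]
  exact Submodule.smul_mem _ c (hw x)

theorem whittakerVectors_eq_whittakerSpace_of_surjective
    {φ : D.StandardWhittaker lam →ₗ⁅ℂ,g⁆ V} (hφ : Function.Surjective φ) :
    D.whittakerVectors V = D.whittakerSpace V lam := by
  refine Set.Subset.antisymm (fun w hw => ?_) (D.whittakerSpace_subset_whittakerVectors V)
  rcases eq_or_ne w 0 with rfl | hw₀
  · exact zero_mem _
  obtain ⟨v, hv, hv₀, hvW⟩ := D.exists_mem_whittakerSpace_ne_zero hφ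
    (fun x v hv => D.lie_mem_span_singleton hw x hv) (by simpa using hw₀)
  obtain ⟨c, rfl⟩ := Submodule.mem_span_singleton.1 hv
  exact (Submodule.smul_mem_iff _ (left_ne_zero_of_smul hv₀)).1 hvW

lemma finrank_whittakerSpace_lieSubmodule (hV : finrank ℂ (D.whittakerSpace V lam) = 1)
    {N : LieSubmodule ℂ g V} {w : V} (hw : w ∈ D.whittakerSpace V lam) (hwN : w ∈ N)
    (hw₀ : w ≠ 0) : finrank ℂ (D.whittakerSpace N lam) = 1 := by
  refine finrank_eq_one ⟨⟨w, hwN⟩, fun x => Subtype.ext (hw x)⟩ (fun h => hw₀ ?_)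
    fun ⟨⟨v, hvN⟩, hv⟩ => ?_
  · exact congrArg (fun u : D.whittakerSpace N lam => (u : V)) h
  · have hvW : v ∈ D.whittakerSpace V lam := fun x => congrArg Subtype.val (hv x)
    rw [eq_span_singleton_of_mem_of_finrank_eq_one hV hw hw₀] at hvW
    obtain ⟨c, rfl⟩ := Submodule.mem_span_singleton.1 hvW
    exact ⟨c, rfl⟩

lemma finrank_whittakerSpace_range {φ : D.StandardWhittaker lam →ₗ⁅ℂ,g⁆ V} (hφ : φ ≠ 0)
    (hV : finrank ℂ (D.whittakerSpace V lam) = 1) :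
    finrank ℂ (D.whittakerSpace φ.range lam) = 1 :=
  D.finrank_whittakerSpace_lieSubmodule hV (D.map_generator_mem_whittakerSpace φ)
    (φ.mem_range_self _) (D.map_generator_ne_zero hφ)

theorem isIrreducible_range {φ : D.StandardWhittaker lam →ₗ⁅ℂ,g⁆ V} (hφ : φ ≠ 0)
    (hV : finrank ℂ (D.whittakerSpace V lam) = 1) : LieModule.IsIrreducible ℂ g φ.range :=
  D.isIrreducible_of_surjective (rangeRestrict_surjective φ) (D.finrank_whittakerSpace_range hφ hV)

lemma exists_hom_ne_zero (hV : D.whittakerSpace V lam ≠ ⊥) :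
    ∃ φ : D.StandardWhittaker lam →ₗ⁅ℂ,g⁆ V, φ ≠ 0 := by
  obtain ⟨w, hw, hw₀⟩ := (Submodule.ne_bot_iff _).1 hV
  obtain ⟨φ, rfl, -⟩ := Induced.existsUnique_hom hw
  exact ⟨φ, fun h => hw₀ (by rw [h, LieModuleHom.zero_apply])⟩

end TriangularDecomposition

/-! ## Local finiteness -/

lemma exists_fg_lieSubmodule_lie_mem {R L V : Type*} [CommRing R] [LieRing L] [LieAlgebra R L]
    {n : LieSubalgebra R L} [AddCommGroup V] [Module R V] [LieRingModule L V] [LieModule R L V]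
    {F : Submodule R L} (hF : F.FG)
    (hnF : ∀ x ∈ n, ∀ y ∈ F, ⁅x, y⁆ ∈ F ⊔ n.toSubmodule)
    {E : LieSubmodule R n V} (hE : E.toSubmodule.FG) :
    ∃ E' : LieSubmodule R n V, E'.toSubmodule.FG ∧ ∀ y ∈ F, ∀ w ∈ E, ⁅y, w⁆ ∈ E' := by
  let E' := E.toSubmodule ⊔ F.map₂ (LieModule.toEnd R L V).toLinearMap E.toSubmodule
  have lie_mem_E' {y : L} (hy : y ∈ F) {w : V} (hw : w ∈ E) : ⁅y, w⁆ ∈ E' :=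
    Submodule.mem_sup_right (Submodule.apply_mem_map₂ _ hy hw)
  suffices ∀ x : n, E' ≤ E'.comap (LieModule.toEnd R L V x) from
    ⟨{ E' with lie_mem := fun {x _} hw => this x hw }, hE.sup (hF.map₂ _ hE),
      fun y hy w hw => lie_mem_E' hy hw⟩
  refine fun x => sup_le (fun w hw => Submodule.mem_sup_left (E.lie_mem hw (x := x)))
    (Submodule.map₂_le.2 fun y hy w hw => ?_)
  change ⁅(x : L), ⁅y, w⁆⁆ ∈ E'
  obtain ⟨y', hy', x', hx', hxy⟩ := Submodule.mem_sup.1 (hnF x x.2 y hy)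
  rw [leibniz_lie, ← hxy, add_lie]
  refine add_mem (add_mem (lie_mem_E' hy' hw) ?_) (lie_mem_E' hy (E.lie_mem hw (x := x)))
  exact Submodule.mem_sup_left (E.lie_mem hw (x := ⟨x', hx'⟩))

namespace TriangularDecomposition

variable {g : Type u} [LieRing g] [LieAlgebra ℂ g] (D : TriangularDecomposition g)
  {lam : LieCharacter ℂ D.nPos}
variable {V : Type*} [AddCommGroup V] [Module ℂ V] [LieRingModule g V] [LieModule ℂ g V]

theorem isWhittakerModule_of_surjective
    (hD : ∀ y : g, ∃ F : Submodule ℂ g, F.FG ∧ y ∈ F ∧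
      ∀ x ∈ D.nPos, ∀ y ∈ F, ⁅x, y⁆ ∈ F ⊔ D.nPos.toSubmodule)
    {φ : D.StandardWhittaker lam →ₗ⁅ℂ,g⁆ V} (hφ : Function.Surjective φ) :
    D.IsWhittakerModule V := by
  intro w
  obtain ⟨m, rfl⟩ := hφ w
  suffices ∃ E : LieSubmodule ℂ D.nPos V, E.toSubmodule.FG ∧ φ m ∈ E by
    obtain ⟨E, hE, hm⟩ := this
    have : FiniteDimensional ℂ E.toSubmodule := Module.Finite.iff_fg.2 hE
    exact Submodule.finiteDimensional_of_le
      (LieSubmodule.lieSpan_le.2 (Set.singleton_subset_iff.2 hm))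
  induction m using Induced.induction with
  | generator =>
    have hW : φ (Induced.generator D.nPos lam) ∈ D.whittakerVectors V :=
      D.whittakerSpace_subset_whittakerVectors V (D.map_generator_mem_whittakerSpace φ)
    exact ⟨{ Submodule.span ℂ {φ (Induced.generator D.nPos lam)} with
        lie_mem := fun {x _} hv => D.lie_mem_span_singleton hW x hv },
      Submodule.fg_span_singleton _, Submodule.mem_span_singleton_self _⟩
  | add m m' hm hm' =>
    obtain ⟨E, hE, hm⟩ := hm
    obtain ⟨E', hE', hm'⟩ := hm'
    refine ⟨E ⊔ E', ?_, ?_⟩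
    · rw [LieSubmodule.sup_toSubmodule]
      exact hE.sup hE'
    · rw [map_add]
      exact add_mem (LieSubmodule.mem_sup_left hm) (LieSubmodule.mem_sup_right hm')
  | smul c m hm =>
    obtain ⟨E, hE, hm⟩ := hm
    exact ⟨E, hE, by rw [map_smul]; exact E.smul_mem c hm⟩
  | lie y m hm =>
    obtain ⟨E, hE, hm⟩ := hm
    obtain ⟨F, hF, hy, hnF⟩ := hD y
    obtain ⟨E', hE', lie_mem⟩ := exists_fg_lieSubmodule_lie_mem hF hnF hE
    exact ⟨E', hE', by rw [LieModuleHom.map_lie]; exact lie_mem y hy _ hm⟩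

end TriangularDecomposition

/-! ## The Virasoro algebra -/

namespace Virasoro

lemma wittBracket_apply_eq_zero_of_le_two {x y : ℤ →₀ ℂ}
    (hx : x ∈ Finsupp.supported ℂ ℂ {i : ℤ | 0 < i})
    (hy : y ∈ Finsupp.supported ℂ ℂ {i : ℤ | 0 < i}) {k : ℤ} (hk : k ≤ 2) :
    wittBracket x y k = 0 := by
  rw [wittBracket, Finsupp.lift_apply, Finsupp.sum, LinearMap.sum_apply, Finsupp.finsetSum_apply]
  refine Finset.sum_eq_zero fun i hi => ?_
  rw [LinearMap.smul_apply, Finsupp.lift_apply, Finsupp.sum, Finsupp.smul_apply,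
    Finsupp.finsetSum_apply, Finset.sum_eq_zero, smul_zero]
  intro j hj
  have hi : 0 < i := hx hi
  have hj : 0 < j := hy hj
  rw [Finsupp.smul_apply, Finsupp.single_apply]
  split_ifs with hij
  · obtain rfl : i = 1 := by omega
    obtain rfl : j = 1 := by omega
    rw [sub_self, smul_zero]
  · exact smul_zero _

/-- The character of `n₊` with the values `a` at `e 1` and `b` at `e 2`. -/
def nPosCharacter (a b : ℂ) : LieCharacter ℂ nPos where
  toLinearMap := (a • Finsupp.lapply 1 + b • Finsupp.lapply 2 : (ℤ →₀ ℂ) →ₗ[ℂ] ℂ) ∘ₗ coeffₗ ∘ₗ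
    nPos.toSubmodule.subtype
  map_lie' {x y} := by
    have coeff_lie_eq_zero {k : ℤ} (hk : k ≤ 2) : ⁅(x : Virasoro), (y : Virasoro)⁆.coeff k = 0 :=
      wittBracket_apply_eq_zero_of_le_two x.2.1 y.2.1 hk
    rw [(Commute.all _ _).lie_eq]
    change a * ⁅(x : Virasoro), (y : Virasoro)⁆.coeff 1 +
      b * ⁅(x : Virasoro), (y : Virasoro)⁆.coeff 2 = 0
    rw [coeff_lie_eq_zero one_le_two, coeff_lie_eq_zero le_rfl, mul_zero, mul_zero, add_zero]

lemma nPosCharacter_apply (a b : ℂ) (x : nPos) :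
    nPosCharacter a b x = a * (x : Virasoro).coeff 1 + b * (x : Virasoro).coeff 2 := rfl

lemma lieCharacter_e_eq_zero (lam : LieCharacter ℂ nPos) {i : ℤ} (hi : 2 < i) :
    lam ⟨e i, e_mem_nPos (by omega)⟩ = 0 := by
  have e_one_lie : ⁅(⟨e 1, e_mem_nPos one_pos⟩ : nPos), ⟨e (i - 1), e_mem_nPos (by omega)⟩⁆ =
      ((i : ℂ) - 2) • (⟨e i, e_mem_nPos (by omega)⟩ : nPos) := by
    apply Subtype.ext
    change ⁅e 1, e (i - 1)⁆ = ((i : ℂ) - 2) • e i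
    rw [e_lie_e, if_neg (by omega), zero_smul, add_zero, add_sub_cancel]
    congr 1
    push_cast
    ring
  have sub_two_smul_eq_zero : ((i : ℂ) - 2) • lam ⟨e i, e_mem_nPos (by omega)⟩ = 0 := by
    rw [← map_smul, ← e_one_lie, lieCharacter_apply_lie]
  have sub_two_ne_zero : (i : ℂ) - 2 ≠ 0 := sub_ne_zero.2 (mod_cast hi.ne')
  exact (smul_eq_zero.1 sub_two_smul_eq_zero).resolve_left sub_two_ne_zero

lemma lieCharacter_ext {lam lam' : LieCharacter ℂ nPos}
    (h1 : lam ⟨e 1, e_mem_nPos (by norm_num)⟩ = lam' ⟨e 1, e_mem_nPos (by norm_num)⟩)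
    (h2 : lam ⟨e 2, e_mem_nPos (by norm_num)⟩ = lam' ⟨e 2, e_mem_nPos (by norm_num)⟩) :
    lam = lam' := by
  have eq_e {i : ℤ} (hi : 0 < i) : lam ⟨e i, e_mem_nPos hi⟩ = lam' ⟨e i, e_mem_nPos hi⟩ := by
    rcases lt_or_ge 2 i with h | h
    · rw [lieCharacter_e_eq_zero lam h, lieCharacter_e_eq_zero lam' h]
    · obtain rfl | rfl : i = 1 ∨ i = 2 := by omega
      exacts [h1, h2]
  ext x
  have x_eq_sum : x = ∑ i ∈ (x : Virasoro).coeff.support.attach,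
      (x : Virasoro).coeff i • (⟨e i, e_mem_nPos (x.2.1 i.2)⟩ : nPos) := by
    apply Subtype.ext
    rw [AddSubmonoidClass.coe_finsetSum]
    exact (eq_sum x.2).trans (Finset.sum_attach _ fun i => (x : Virasoro).coeff i • e i).symm
  rw [x_eq_sum, map_sum, map_sum]
  exact Finset.sum_congr rfl fun i _ => by rw [map_smul, map_smul, eq_e (x.2.1 i.2)]

theorem existsUnique_lieCharacter (a b : ℂ) : ∃! lam : LieCharacter ℂ nPos,
    lam ⟨e 1, e_mem_nPos (by norm_num)⟩ = a ∧ lam ⟨e 2, e_mem_nPos (by norm_num)⟩ = b := by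
  have apply_e_one : nPosCharacter a b ⟨e 1, e_mem_nPos (by norm_num)⟩ = a := by
    simp [nPosCharacter_apply, e]
  have apply_e_two : nPosCharacter a b ⟨e 2, e_mem_nPos (by norm_num)⟩ = b := by
    simp [nPosCharacter_apply, e]
  exact ⟨nPosCharacter a b, ⟨apply_e_one, apply_e_two⟩, fun lam h =>
    lieCharacter_ext (h.1.trans apply_e_one.symm) (h.2.trans apply_e_two.symm)⟩

lemma fg_comap_supported {s : Set ℤ} (hs : s.Finite) :
    ((Finsupp.supported ℂ ℂ s).comap coeffₗ).FG := by
  refine Submodule.fg_of_fg_map_of_fg_inf_ker coeffₗ ?_ ?_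
  · have fg_supported : (Finsupp.supported ℂ ℂ s).FG := by
      rw [Finsupp.supported_eq_span_single]
      exact Submodule.fg_span (hs.image _)
    exact fg_supported.of_le (Submodule.map_comap_le _ _)
  · refine (Submodule.fg_span_singleton z).of_le fun x hx => ?_
    refine Submodule.mem_span_singleton.2 ⟨x.central, Virasoro.ext ?_ (mul_one _)⟩
    exact (smul_zero _).trans hx.2.symm

lemma comap_supported_Ici_le {l m : ℤ} (hm : 0 ≤ m) :
    (Finsupp.supported ℂ ℂ (Set.Ici l)).comap coeffₗ ≤
      (Finsupp.supported ℂ ℂ (Set.Icc l m)).comap coeffₗ ⊔ nPos.toSubmodule := by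
  intro x hx
  have x_eq : x = ⟨x.coeff.filter (· ≤ m), x.central⟩ + ⟨x.coeff.filter (¬ · ≤ m), 0⟩ :=
    Virasoro.ext (Finsupp.filter_add_filter_not _ _).symm (add_zero _).symm
  rw [x_eq]
  refine Submodule.add_mem_sup (fun i hi => ?_) ((mem_nPos_iff _).2 ⟨fun i hi => ?_, rfl⟩)
  · obtain ⟨hi, him⟩ := Finset.mem_filter.1 hi
    exact ⟨hx hi, him⟩
  · exact Finsupp.filter_apply_neg _ _ (not_not.2 (hi.trans hm))

theorem exists_fg_lie_mem_sup_nPos (y : Virasoro) :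
    ∃ F : Submodule ℂ Virasoro, F.FG ∧ y ∈ F ∧
      ∀ x ∈ nPos, ∀ v ∈ F, ⁅x, v⁆ ∈ F ⊔ nPos.toSubmodule := by
  obtain ⟨m, hm0, hm⟩ : ∃ m : ℤ, 0 ≤ m ∧ ∀ i ∈ y.coeff.support, |i| ≤ m :=
    ⟨∑ i ∈ y.coeff.support, |i|, Finset.sum_nonneg fun _ _ => abs_nonneg _, fun i hi =>
      Finset.single_le_sum (f := fun i : ℤ => |i|) (fun _ _ => abs_nonneg _) hi⟩
  refine ⟨(Finsupp.supported ℂ ℂ (Set.Icc (-m) m)).comap coeffₗ,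
    fg_comap_supported (Set.finite_Icc _ _), fun i hi => abs_le.1 (hm i hi), fun x hx v hv => ?_⟩
  refine comap_supported_Ici_le hm0 (wittBracket_mem (fun i (hi : 0 < i) j hj => ?_) hx.1 hv)
  exact hj.1.trans (le_add_of_nonneg_left hi.le)

end Virasoro

end WhittakerPairs

end

theorem corollary43 :
    (∀ (g : Type u) [LieRing g] [LieAlgebra ℂ g] (D : TriangularDecomposition g)
        (lam : LieAlgebra.LieCharacter ℂ D.nPos) (mu : Module.Dual ℂ D.cartan),
      -- the homomorphism `M_lam → N(-mu)*` that defines `L(lam, mu)` exists and is unique up to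
      -- a nonzero scalar
      Module.finrank ℂ (D.whittakerSpace (Module.Dual ℂ (D.LowestVerma (-mu))) lam) = 1 ∧
      (∀ w ∈ D.whittakerSpace (Module.Dual ℂ (D.LowestVerma (-mu))) lam,
        ∃! φ : D.StandardWhittaker lam →ₗ⁅ℂ, g⁆ Module.Dual ℂ (D.LowestVerma (-mu)),
          φ (Induced.generator D.nPos lam) = w) ∧
      -- its image `L(lam, mu)` is simple and has a one-dimensional space of Whittaker vectors
      ∀ φ : D.StandardWhittaker lam →ₗ⁅ℂ, g⁆ Module.Dual ℂ (D.LowestVerma (-mu)), φ ≠ 0 →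
        LieModule.IsIrreducible ℂ g φ.range ∧
        Module.finrank ℂ (D.whittakerSpace φ.range lam) = 1 ∧
        D.whittakerVectors φ.range = D.whittakerSpace φ.range lam) ∧
    -- the Virasoro algebra: the characters of `n₊` are given by arbitrary values at `e 1`, `e 2`
    (∀ a b : ℂ, ∃! lam : LieAlgebra.LieCharacter ℂ Virasoro.triangularDecomposition.nPos,
      lam ⟨Virasoro.e 1, Virasoro.e_mem_nPos (by norm_num)⟩ = a ∧
      lam ⟨Virasoro.e 2, Virasoro.e_mem_nPos (by norm_num)⟩ = b) ∧
    (∀ (lam : LieAlgebra.LieCharacter ℂ Virasoro.triangularDecomposition.nPos)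
        (mu : Module.Dual ℂ Virasoro.triangularDecomposition.cartan),
      ∃ φ : Virasoro.triangularDecomposition.StandardWhittaker lam →ₗ⁅ℂ, Virasoro⁆
          Module.Dual ℂ (Virasoro.triangularDecomposition.LowestVerma (-mu)),
        φ ≠ 0 ∧
        LieModule.IsIrreducible ℂ Virasoro φ.range ∧
        Virasoro.triangularDecomposition.IsWhittakerModule φ.range ∧
        Module.finrank ℂ (Virasoro.triangularDecomposition.whittakerSpace φ.range lam) = 1) := by
  refine ⟨fun g _ _ D lam mu => ?_, Virasoro.existsUnique_lieCharacter, fun lam mu => ?_⟩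
  · have hV := D.finrank_whittakerSpace_dual_lowestVerma lam (-mu)
    exact ⟨hV, fun w hw => Induced.existsUnique_hom hw, fun φ hφ =>
      ⟨D.isIrreducible_range hφ hV, D.finrank_whittakerSpace_range hφ hV,
        D.whittakerVectors_eq_whittakerSpace_of_surjective (rangeRestrict_surjective φ)⟩⟩
  · let D := Virasoro.triangularDecomposition
    have hV := D.finrank_whittakerSpace_dual_lowestVerma lam (-mu)
    obtain ⟨φ, hφ⟩ := D.exists_hom_ne_zero
      (Submodule.nontrivial_iff_ne_bot.1 (Module.nontrivial_of_finrank_eq_succ hV))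
    exact ⟨φ, hφ, D.isIrreducible_range hφ hV,
      D.isWhittakerModule_of_surjective Virasoro.exists_fg_lie_mem_sup_nPos
        (rangeRestrict_surjective φ),
      D.finrank_whittakerSpace_range hφ hV⟩
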